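/- For $g\in\{3,4,5\}$ let $\mathcal T_g$ be the set of pairs $(a,b)$ of positive integers with $a\le b$ and $\gcd(a,b)=g$ that are the side lengths of a lattice equable parallelogram, that is, of a (nondegenerate) parallelogram with vertices in $\mathbb Z^2$ whose perimeter equals its area. Put $\Delta=a^2b^2-4(a+b)^2$ and define $$\varphi_{1},\varphi_2:(a,b)\mapsto\Bigl(a,\tfrac{a^2b\pm a\sqrt{\Delta}}2-2a-b\Bigr),\qquad \psi_{1},\psi_2:(a,b)\mapsto\Bigl(\tfrac{ab^2\pm b\sqrt{\Delta}}2-2b-a,\;b\Bigr),$$ with the sign $+$ for the index $1$ and $-$ for the index $2$; after applying one of these maps the two entries of the image are interchanged if necessary, so that the first is at most the second. Join two distinct elements of $\mathcal T_g$ by an edge if one of the four maps sends one of them to the other. Let $(f,s)=(1,3),(2,2),(5,1)$ and $\rho_g=(3,6),(4,4),(5,5)$ for $g=3,4,5$ respectively. Let $S$ be the set of positive integer solutions $(m,n,q)$ of the Markov–Rosenberger equation $m^2+n^2+fq^2=fs\,mnq$, with the maps $$\phi_1(m,n,q)=(fsnq-m,n,q),\quad \phi_2(m,n,q)=(m,fsmq-n,q),\quad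 \phi_3(m,n,q)=(m,n,smn-q).$$ Make $S$ a graph by joining two distinct solutions whenever some $\phi_i$ sends one to the other, and let $\tau(m,n,q)=(n,m,q)$. Then for each $g=3,4,5$: 1. $\mathcal T_g$ is infinite, and the graph on it is a tree. The four maps send $\mathcal T_g$ into itself, and two elements of $\mathcal T_g$ are adjacent if and only if one of the four maps sends the first to the second. 2. $\phi_1,\phi_2,\phi_3$ map $S$ into itself. For $g=3,4$ the graph $S$ is a tree. For $g=5$ it is a forest consisting of exactly two trees, which are interchanged by $\tau$. In all three cases the quotient graph $S/\tau$ is a tree. 3. The tree $\mathcal T_g$ is obtained from $S/\tau$ by contracting the edges given by $\phi_3$: the map sending $(m,n,q)$ to the pair with entries $fsq$ and $fs(smn-q)$, in increasing order, induces a graph isomorphism from the contracted graph onto $\mathcal T_g$. 4. The root $\rho_g$ belongs to $\mathcal T_g$ and is the unique element of $\mathcal T_g$ for which $a+b$ is minimal. Every vertex of $\mathcal T_g$ other than the root has degree $4$. The roots $(3,6)$ and $(5,5)$ have degree $2$, and the root $(4,4)$ has degree $1$. -/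

import Mathlib

noncomputable section

namespace LEP

/-! ## Lattice equable parallelograms and their side pairs -/

/-- A parallelogram with vertices in `ℤ²`: its vertices, in cyclic order, are
`base`, `base + u`, `base + u + v`, `base + v`, and it is nondegenerate. -/
structure LatticeParallelogram where
  base : ℤ × ℤ
  u : ℤ × ℤ
  v : ℤ × ℤ
  nondeg : u.1 * v.2 - u.2 * v.1 ≠ 0

/-- Euclidean length of an integer vector. -/
def length (w : ℤ × ℤ) : ℝ := √((w.1 : ℝ) ^ 2 + (w.2 : ℝ) ^ 2)

/-- Area of a lattice parallelogram. -/
def LatticeParallelogram.area (P : LatticeParallelogram) : ℝ :=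
  |(P.u.1 : ℝ) * P.v.2 - P.u.2 * P.v.1|

/-- Perimeter of a lattice parallelogram. -/
def LatticeParallelogram.perimeter (P : LatticeParallelogram) : ℝ :=
  2 * (length P.u + length P.v)

/-- A lattice parallelogram is equable if its perimeter equals its area. -/
def LatticeParallelogram.IsEquable (P : LatticeParallelogram) : Prop :=
  P.perimeter = P.area

/-- The set `T_g`: pairs `(a, b)` of positive integers with `a ≤ b` and `gcd (a, b) = g` which are
the side lengths of a lattice equable parallelogram. -/
def sidePairs (g : ℕ) : Set (ℤ × ℤ) :=
  {p | 0 < p.1 ∧ p.1 ≤ p.2 ∧ Int.gcd p.1 p.2 = g ∧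
    ∃ P : LatticeParallelogram, P.IsEquable ∧ length P.u = p.1 ∧ length P.v = p.2}

/-! ## The four maps and the graph on `T_g` -/

/-- `√(a² b² - 4 (a + b)²)`. -/
def disc (a b : ℝ) : ℝ := √(a ^ 2 * b ^ 2 - 4 * (a + b) ^ 2)

def varphi₁ (p : ℝ × ℝ) : ℝ × ℝ :=
  (p.1, (p.1 ^ 2 * p.2 + p.1 * disc p.1 p.2) / 2 - 2 * p.1 - p.2)

def varphi₂ (p : ℝ × ℝ) : ℝ × ℝ :=
  (p.1, (p.1 ^ 2 * p.2 - p.1 * disc p.1 p.2) / 2 - 2 * p.1 - p.2)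

def psi₁ (p : ℝ × ℝ) : ℝ × ℝ :=
  ((p.1 * p.2 ^ 2 + p.2 * disc p.1 p.2) / 2 - 2 * p.2 - p.1, p.2)

def psi₂ (p : ℝ × ℝ) : ℝ × ℝ :=
  ((p.1 * p.2 ^ 2 - p.2 * disc p.1 p.2) / 2 - 2 * p.2 - p.1, p.2)

/-- The four maps. -/
def sideMaps : Set (ℝ × ℝ → ℝ × ℝ) := {varphi₁, varphi₂, psi₁, psi₂}

/-- Reverse a pair if necessary so that the first entry is at most the second. -/
def sortPair {α : Type*} [LinearOrder α] (p : α × α) : α × α := (min p.1 p.2, max p.1 p.2)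

/-- An integer pair regarded as a real pair. -/
def toReal (p : ℤ × ℤ) : ℝ × ℝ := ((p.1 : ℝ), (p.2 : ℝ))

/-- The graph on `T_g`: two distinct pairs are joined by an edge if one of the four maps,
followed by sorting, sends one of them to the other. -/
def sideGraph (g : ℕ) : SimpleGraph (sidePairs g) :=
  SimpleGraph.fromRel fun p p' => ∃ F ∈ sideMaps, sortPair (F (toReal p.1)) = toReal p'.1

/-! ## Positive solutions of `m² + n² + f q² = f s m n q` -/

/-- The positive integer solutions `(m, n, q)` of `m² + n² + f q² = f s m n q`. -/
def solutions (f s : ℤ) : Set (ℤ × ℤ × ℤ) :=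
  {x | 0 < x.1 ∧ 0 < x.2.1 ∧ 0 < x.2.2 ∧
    x.1 ^ 2 + x.2.1 ^ 2 + f * x.2.2 ^ 2 = f * s * x.1 * x.2.1 * x.2.2}

def phi₁ (f s : ℤ) (x : ℤ × ℤ × ℤ) : ℤ × ℤ × ℤ := (f * s * x.2.1 * x.2.2 - x.1, x.2.1, x.2.2)

def phi₂ (f s : ℤ) (x : ℤ × ℤ × ℤ) : ℤ × ℤ × ℤ := (x.1, f * s * x.1 * x.2.2 - x.2.1, x.2.2)

def phi₃ (s : ℤ) (x : ℤ × ℤ × ℤ) : ℤ × ℤ × ℤ := (x.1, x.2.1, s * x.1 * x.2.1 - x.2.2)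

/-- The graph on the set of solutions: two distinct solutions are joined by an edge if one of
`φ₁, φ₂, φ₃` sends one of them to the other. -/
def solutionGraph (f s : ℤ) : SimpleGraph (solutions f s) :=
  SimpleGraph.fromRel fun x y =>
    y.1 = phi₁ f s x.1 ∨ y.1 = phi₂ f s x.1 ∨ y.1 = phi₃ s x.1

/-- The swap `(m, n, q) ↦ (n, m, q)`. -/
def swap {f s : ℤ} (x : solutions f s) : solutions f s :=
  ⟨(x.1.2.1, x.1.1, x.1.2.2), by
    obtain ⟨⟨m, n, q⟩, hm, hn, hq, h⟩ := x
    exact ⟨hn, hm, hq, by simp only at h ⊢; linarith⟩⟩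

/-- The graph obtained from `G` by identifying vertices related by `r`
(and dropping the loops which this creates). -/
def quotGraph {V : Type*} (G : SimpleGraph V) (r : V → V → Prop) : SimpleGraph (Quot r) where
  Adj A B := A ≠ B ∧ ∃ x y, Quot.mk r x = A ∧ Quot.mk r y = B ∧ G.Adj x y
  symm := ⟨fun _ _ h => ⟨h.1.symm, by
    obtain ⟨x, y, hx, hy, hxy⟩ := h.2
    exact ⟨y, x, hy, hx, hxy.symm⟩⟩⟩
  loopless := ⟨fun _ h => h.1 rfl⟩

/-- The relation identifying a solution with its swap. -/
def swapRel (f s : ℤ) (x y : solutions f s) : Prop := y = swap x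

/-- The quotient of the solution graph by the swap. -/
def swapQuotient (f s : ℤ) : SimpleGraph (Quot (swapRel f s)) :=
  quotGraph (solutionGraph f s) (swapRel f s)

/-- Two classes modulo the swap are related if `φ₃` sends a member of the first to a member of
the second. -/
def phi₃Rel (f s : ℤ) (A B : Quot (swapRel f s)) : Prop :=
  ∃ x y : solutions f s, Quot.mk _ x = A ∧ Quot.mk _ y = B ∧ y.1 = phi₃ s x.1

/-- The graph obtained from `swapQuotient f s` by contracting the edges given by `φ₃`. -/
def contractedGraph (f s : ℤ) : SimpleGraph (Quot (phi₃Rel f s)) :=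
  quotGraph (swapQuotient f s) (phi₃Rel f s)

/-- The pair of sides `(f s q, f s (s m n - q))`, sorted, attached to `(m, n, q)`. -/
def sidesOf (f s : ℤ) (x : ℤ × ℤ × ℤ) : ℤ × ℤ :=
  sortPair (f * s * x.2.2, f * s * (s * x.1 * x.2.1 - x.2.2))

end LEP

end

noncomputable section

namespace LEP

/-! ## Graphs given by a parent function -/

/-! Arithmetic of side pairs. Two lattice vectors of lengths `a`, `b` satisfy `det² + dot² = a² b²`,
so equability forces `a² b² - 4 (a + b)²` to be a square `h²`. Conversely `h + 2 (a + b) i` is then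
a Gaussian integer of norm `a² b²`; unique factorisation splits it into factors of norms `a²` and
`b²`, and these give the parallelogram (`mem_sidePairs_iff`).

Parametrisation. Write `a = f s q`, `b = f s q'` with `q`, `q'` coprime. The discriminant condition
makes `(f s q q' + 2 (q + q')) (f s q q' - 2 (q + q'))` a square, so both factors are a common `e`
times squares, and coprimality gives `e ∣ 4 f s`. Congruences, and for `g = 5` also the insolubility
of `m² + n² + q² = 5 m n q`, leave only those `e` for which `s m n = q + q'` and `m² + n² = f q q'`
are solvable; this is the Markov–Rosenberger equation (`exists_solution`). Its Vieta involution in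
`q` exchanges `q` and `q'`, and sides determine `(m, n, q)` up to that involution and the swap
(`eq_of_sidesOf_eq`). The discriminant equals `(f s² (m² - n²))²`, so the four side maps are `φ₁`
and `φ₂` applied to the solution and to its `φ₃`-image (`exists_sideMaps_iff`).

Trees. At most one of the `φᵢ` lowers a given solution, and each edge joins a solution to its image
under the lowering map. A graph given by such a parent function is a forest with one tree per fixed
point (`isTree_of_parent`, `reachable_iff_of_parent`), so it remains to find the solutions that no
`φᵢ` lowers (`eq_root_of_parent_eq_self`). The same argument serves the solutions, their quotient by
the swap, and the side pairs, where the height is `a + b = f s² m n`. Degrees follow by deciding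
when the four images of a pair coincide: only if `m = n` or `q = q'`, which happens only at the
root. -/

theorem isAcyclic_of_parent {V : Type*} {G : SimpleGraph V} (p : V → V) (h : V → ℕ)
    (hp : ∀ x, p x ≠ x → h (p x) < h x) (hG : ∀ x y, G.Adj x y → p x = y ∨ p y = x) :
    G.IsAcyclic := by
  classical
  intro v c hc
  -- At a vertex of maximal height on a cycle, both neighbours along the cycle must be its parent,
  -- but on a cycle they are distinct.
  obtain ⟨u, hu, hmax⟩ := c.support.toFinset.exists_max_image h ⟨v, by simp⟩
  rw [List.mem_toFinset] at hu
  have hc' := hc.rotate hu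
  have key : ∀ w, w ∈ (c.rotate u hu).support → G.Adj u w → p u = w := by
    intro w hw huw
    refine (hG u w huw).resolve_right fun h1 => ?_
    have h2 := hp w (by rw [h1]; exact huw.ne)
    have h3 := hmax w (by
      rw [List.mem_toFinset]
      exact (c.mem_support_rotate_iff u hu).1 hw)
    rw [h1] at h2
    omega
  have hnil := hc'.not_nil
  refine hc'.snd_ne_penultimate ?_
  exact (key _ ((c.rotate u hu).getVert_mem_support _) ((c.rotate u hu).adj_snd hnil)).symm.trans
    (key _ ((c.rotate u hu).getVert_mem_support _) ((c.rotate u hu).adj_penultimate hnil).symm)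

/-- Every step that moves lowers `h`, so `h x` steps already reach a fixed point; `p^[h x] x` thus
serves as the root above `x`. -/
theorem iterate_parent_fixed {V : Type*} (p : V → V) (h : V → ℕ)
    (hp : ∀ x, p x ≠ x → h (p x) < h x) (n : ℕ) (x : V) (hn : h x ≤ n) :
    p (p^[n] x) = p^[n] x := by
  induction n generalizing x with
  | zero =>
    by_contra hne
    have := hp x hne
    omega
  | succ n ih =>
    by_cases hx : p x = x
    · rw [Function.iterate_fixed hx, hx]
    · have := hp x hx
      rw [Function.iterate_succ_apply]
      exact ih _ (by omega)

theorem iterate_parent_eq {V : Type*} (p : V → V) (h : V → ℕ)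
    (hp : ∀ x, p x ≠ x → h (p x) < h x) (n : ℕ) (x : V) (hn : h x ≤ n) :
    p^[n] x = p^[h x] x := by
  obtain ⟨k, rfl⟩ := Nat.exists_eq_add_of_le' hn
  rw [Function.iterate_add_apply,
    Function.iterate_fixed (iterate_parent_fixed p h hp _ x le_rfl)]

theorem reachable_iterate_parent {V : Type*} {G : SimpleGraph V} (p : V → V)
    (hG : ∀ x, p x ≠ x → G.Adj x (p x)) (n : ℕ) (x : V) : G.Reachable x (p^[n] x) := by
  induction n with
  | zero => exact SimpleGraph.Reachable.refl _
  | succ n ih =>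
    rw [Function.iterate_succ_apply']
    by_cases hx : p (p^[n] x) = p^[n] x
    · rwa [hx]
    · exact ih.trans (hG _ hx).reachable

theorem reachable_iff_of_parent {V : Type*} {G : SimpleGraph V} (p : V → V) (h : V → ℕ)
    (hp : ∀ x, p x ≠ x → h (p x) < h x) (hG : ∀ x y, G.Adj x y → p x = y ∨ p y = x)
    (hG' : ∀ x, p x ≠ x → G.Adj x (p x)) (x y : V) :
    G.Reachable x y ↔ p^[h x] x = p^[h y] y := by
  constructor
  · have step : ∀ x, p^[h (p x)] (p x) = p^[h x] x := by
      intro x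
      rw [← iterate_parent_eq p h hp (h x + h (p x)) (p x) (by omega),
        ← Function.iterate_succ_apply, iterate_parent_eq p h hp _ x (by omega)]
    rintro ⟨w⟩
    induction w with
    | nil => rfl
    | cons hadj _ ih =>
      rw [← ih]
      rcases hG _ _ hadj with h1 | h1
      · rw [← h1, step]
      · rw [← h1, step]
  · intro he
    have h1 := reachable_iterate_parent p hG' (h x) x
    rw [he] at h1
    exact h1.trans (reachable_iterate_parent p hG' (h y) y).symm

theorem isTree_of_parent {V : Type*} {G : SimpleGraph V} (p : V → V) (h : V → ℕ)
    (hp : ∀ x, p x ≠ x → h (p x) < h x) (hG : ∀ x y, G.Adj x y → p x = y ∨ p y = x)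
    (hG' : ∀ x, p x ≠ x → G.Adj x (p x)) (r : V) (hr : ∀ x, p x = x → x = r) :
    G.IsTree where
  connected :=
    { preconnected := fun x y => by
        rw [reachable_iff_of_parent p h hp hG hG',
          hr _ (iterate_parent_fixed p h hp _ x le_rfl),
          hr _ (iterate_parent_fixed p h hp _ y le_rfl)]
      nonempty := ⟨r⟩ }
  isAcyclic := isAcyclic_of_parent p h hp hG

/-! ## Factorisation of Gaussian integers of square norm -/

/-- Such a `p` is a sum of two squares, hence the norm of a Gaussian prime `u`. Since `u` divides `z
* star z`, either `u` or its conjugate divides `z`. -/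
theorem exists_norm_eq_prime_dvd {p : ℕ} (hp : p.Prime) (h4 : p % 4 ≠ 3) {z : GaussianInt}
    (hz : (p : ℤ) ∣ z.norm) : ∃ u : GaussianInt, u.norm = p ∧ u ∣ z := by
  have := Fact.mk hp
  obtain ⟨a, b, hab⟩ := Nat.Prime.sq_add_sq h4
  set u : GaussianInt := ⟨a, b⟩ with hu
  have hun : u.norm = p := by
    rw [Zsqrtd.norm_def, ← hab]; push_cast; simp only [hu]; ring
  have hirr : Irreducible u := by
    refine ⟨fun h1 => ?_, fun x y hxy => ?_⟩
    · rw [← Zsqrtd.norm_eq_one_iff, hun] at h1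
      exact hp.one_lt.ne' (by simpa using h1)
    · have h1 : p = x.norm.natAbs * y.norm.natAbs := by
        rw [← Int.natAbs_mul, ← Zsqrtd.norm_mul, ← hxy, hun]; simp
      rcases (Nat.prime_mul_iff.1 (h1 ▸ hp)) with h2 | h2
      · exact Or.inr (Zsqrtd.norm_eq_one_iff.1 h2.2)
      · exact Or.inl (Zsqrtd.norm_eq_one_iff.1 h2.2)
  have hdvd : u ∣ z * star z := by
    rw [← Zsqrtd.norm_eq_mul_conj]
    have h1 : u ∣ ((p : ℤ) : GaussianInt) := ⟨star u, by rw [← hun, Zsqrtd.norm_eq_mul_conj]⟩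
    exact h1.trans (map_dvd (Int.castRingHom GaussianInt) hz)
  rcases hirr.prime.dvd_or_dvd hdvd with h1 | ⟨v, hv⟩
  · exact ⟨u, hun, h1⟩
  · refine ⟨star u, by rw [Zsqrtd.norm_conj, hun], star v, ?_⟩
    rw [← star_star z, hv, star_mul']

/-- The primes of `a` are stripped off one at a time, each contributing a divisor of norm `p²`: the
inert prime `p` itself if `p ≡ 3` mod 4, and otherwise two successive divisors of norm `p`. -/
theorem exists_norm_eq_sq_dvd (a : ℕ) : ∀ (b : ℤ) (z : GaussianInt),
    z.norm = (a : ℤ) ^ 2 * b ^ 2 → ∃ u : GaussianInt, u.norm = (a : ℤ) ^ 2 ∧ u ∣ z := by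
  induction a using induction_on_primes with
  | zero =>
    intro b z hz
    refine ⟨0, by simp, ?_⟩
    rw [zero_dvd_iff]
    exact (Zsqrtd.norm_eq_zero_iff (by norm_num) z).1 (by simpa using hz)
  | one => exact fun b z _ => ⟨1, by simp, one_dvd z⟩
  | prime_mul p a hp ih =>
    intro b z hz
    have hp0 : (p : ℤ) ≠ 0 := by exact_mod_cast hp.ne_zero
    have key : ∃ u : GaussianInt, u.norm = (p : ℤ) ^ 2 ∧ u ∣ z := by
      by_cases h4 : p % 4 = 3
      · have := Fact.mk hp
        have hpr := GaussianInt.prime_of_nat_prime_of_mod_four_eq_three p h4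
        refine ⟨(p : GaussianInt), by rw [Zsqrtd.norm_natCast]; ring, ?_⟩
        have hd : (p : GaussianInt) ∣ z * star z := by
          rw [← Zsqrtd.norm_eq_mul_conj, hz]
          refine ⟨((p * a ^ 2 * b ^ 2 : ℤ) : GaussianInt), ?_⟩
          push_cast; ring
        rcases hpr.dvd_or_dvd hd with h1 | ⟨v, hv⟩
        · exact h1
        · refine ⟨star v, ?_⟩
          rw [← star_star z, hv, star_mul']
          simp
      · obtain ⟨u, hu, v, rfl⟩ := exists_norm_eq_prime_dvd hp h4 (z := z)
          ⟨p * a ^ 2 * b ^ 2, by rw [hz]; push_cast; ring⟩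
        rw [Zsqrtd.norm_mul, hu] at hz
        have hv : v.norm = p * (a ^ 2 * b ^ 2) :=
          mul_left_cancel₀ hp0 (by rw [hz]; push_cast; ring)
        obtain ⟨u', hu', w, rfl⟩ := exists_norm_eq_prime_dvd hp h4 (z := v) ⟨_, hv⟩
        exact ⟨u * u', by rw [Zsqrtd.norm_mul, hu, hu']; ring, w, by ring⟩
    obtain ⟨u, hu, v, rfl⟩ := key
    rw [Zsqrtd.norm_mul, hu] at hz
    have hv : v.norm = (a : ℤ) ^ 2 * b ^ 2 :=
      mul_left_cancel₀ (pow_ne_zero 2 hp0) (by rw [hz]; push_cast; ring)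
    obtain ⟨u', hu', w, rfl⟩ := ih b v hv
    exact ⟨u * u', by rw [Zsqrtd.norm_mul, hu, hu']; push_cast; ring, w, by ring⟩

/-! ## Side pairs are the pairs of square discriminant -/

theorem length_eq_iff (w : ℤ × ℤ) (a : ℤ) (ha : 0 < a) :
    length w = a ↔ w.1 ^ 2 + w.2 ^ 2 = a ^ 2 := by
  have ha' : (0 : ℝ) < a := by exact_mod_cast ha
  rw [length, Real.sqrt_eq_iff_eq_sq (by positivity) ha'.le]
  constructor
  · intro h; exact_mod_cast h
  · intro h; exact_mod_cast h

theorem mem_sidePairs_iff (g : ℕ) (p : ℤ × ℤ) :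
    p ∈ sidePairs g ↔ 0 < p.1 ∧ p.1 ≤ p.2 ∧ Int.gcd p.1 p.2 = g ∧
      ∃ h : ℤ, p.1 ^ 2 * p.2 ^ 2 - 4 * (p.1 + p.2) ^ 2 = h ^ 2 := by
  obtain ⟨a, b⟩ := p
  simp only [sidePairs, Set.mem_ofPred_eq]
  refine and_congr_right fun ha => and_congr_right fun hab => and_congr_right fun _ => ?_
  have hb : 0 < b := ha.trans_le hab
  constructor
  · rintro ⟨P, hE, hu, hv⟩
    rw [LatticeParallelogram.IsEquable, LatticeParallelogram.perimeter,
      LatticeParallelogram.area, hu, hv] at hE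
    have hE' : 4 * (a + b) ^ 2 = (P.u.1 * P.v.2 - P.u.2 * P.v.1) ^ 2 := by
      have := congrArg (· ^ 2) hE
      simp only [sq_abs] at this
      have h4 : (4 : ℝ) * (a + b) ^ 2 = (P.u.1 * P.v.2 - P.u.2 * P.v.1) ^ 2 := by
        rw [← this]; ring
      exact_mod_cast h4
    rw [length_eq_iff _ _ ha] at hu
    rw [length_eq_iff _ _ hb] at hv
    -- The square root is the inner product of the sides, by Lagrange's identity.
    refine ⟨P.u.1 * P.v.1 + P.u.2 * P.v.2, ?_⟩
    rw [hE', ← hu, ← hv]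
    ring
  · rintro ⟨h, hh⟩
    lift a to ℕ using ha.le
    obtain ⟨u, hu, v, hz⟩ := exists_norm_eq_sq_dvd a b ⟨h, 2 * (a + b)⟩ (by
      rw [Zsqrtd.norm_def]; linear_combination -hh)
    have hv : v.norm = b ^ 2 := by
      have h1 := congrArg Zsqrtd.norm hz
      rw [Zsqrtd.norm_mul, hu, Zsqrtd.norm_def] at h1
      refine mul_left_cancel₀ (pow_ne_zero 2 ha.ne') (h1.symm.trans ?_)
      linear_combination -hh
    have him := congrArg Zsqrtd.im hz
    rw [Zsqrtd.im_mul] at him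
    simp only at him
    rw [Zsqrtd.norm_def] at hu hv
    -- The sides are the conjugate of `u` and `v`, whose determinant is the imaginary part of `u *
    -- v`, namely `2 (a + b)`.
    refine ⟨⟨0, (u.re, -u.im), (v.re, v.im), ?_⟩, ?_, ?_, ?_⟩
    · simp only
      linarith
    · have h1 : length (u.re, -u.im) = (a : ℤ) :=
        (length_eq_iff _ _ ha).2 (by simp only; linarith)
      have h2 : length (v.re, v.im) = b := (length_eq_iff _ _ hb).2 (by simp only; linarith)
      rw [LatticeParallelogram.IsEquable, LatticeParallelogram.perimeter,
        LatticeParallelogram.area, h1, h2]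
      have h3 : (u.re : ℝ) * v.im - ((-u.im : ℤ) : ℝ) * v.re = 2 * ((a : ℤ) + b) := by
        exact_mod_cast (by linarith : u.re * v.im - (-u.im) * v.re = 2 * ((a : ℤ) + b))
      simp only
      rw [h3, abs_of_pos]
      have : (0 : ℝ) < ((a : ℤ) : ℝ) := by exact_mod_cast ha
      have : (0 : ℝ) < b := by exact_mod_cast hb
      linarith
    · exact (length_eq_iff _ _ ha).2 (by simp only; linarith)
    · exact (length_eq_iff _ _ hb).2 (by simp only; linarith)

/-! ## The parent of a solution -/

/-- The parameters `(f, s)` considered. -/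
def Admissible (f s : ℤ) : Prop := (f = 1 ∧ s = 3) ∨ (f = 2 ∧ s = 2) ∨ (f = 5 ∧ s = 1)

theorem Admissible.f_pos {f s : ℤ} (h : Admissible f s) : 0 < f := by
  rcases h with h | h | h <;> omega

theorem Admissible.s_pos {f s : ℤ} (h : Admissible f s) : 0 < s := by
  rcases h with h | h | h <;> omega

theorem phi₁_mapsTo {f s : ℤ} (hf : 0 < f) :
    Set.MapsTo (phi₁ f s) (solutions f s) (solutions f s) := by
  rintro ⟨m, n, q⟩ ⟨hm, hn, hq, h⟩
  simp only at hm hn hq h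
  refine ⟨?_, hn, hq, ?_⟩
  · refine (mul_pos_iff_of_pos_left hm).1 ?_
    have : m * (f * s * n * q - m) = n ^ 2 + f * q ^ 2 := by linear_combination -h
    simp only [phi₁]
    rw [this]
    positivity
  · simp only [phi₁]
    linear_combination h

theorem phi₂_mapsTo {f s : ℤ} (hf : 0 < f) :
    Set.MapsTo (phi₂ f s) (solutions f s) (solutions f s) := by
  rintro ⟨m, n, q⟩ ⟨hm, hn, hq, h⟩
  simp only at hm hn hq h
  refine ⟨hm, ?_, hq, ?_⟩
  · refine (mul_pos_iff_of_pos_left hn).1 ?_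
    have : n * (f * s * m * q - n) = m ^ 2 + f * q ^ 2 := by linear_combination -h
    simp only [phi₂]
    rw [this]
    positivity
  · simp only [phi₂]
    linear_combination h

theorem phi₃_mapsTo {f s : ℤ} (hf : 0 < f) :
    Set.MapsTo (phi₃ s) (solutions f s) (solutions f s) := by
  rintro ⟨m, n, q⟩ ⟨hm, hn, hq, h⟩
  simp only at hm hn hq h
  refine ⟨hm, hn, ?_, ?_⟩
  · refine (mul_pos_iff_of_pos_left (mul_pos hf hq)).1 ?_
    have : f * q * (s * m * n - q) = m ^ 2 + n ^ 2 := by linear_combination -h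
    simp only [phi₃]
    rw [this]
    positivity
  · simp only [phi₃]
    linear_combination h

theorem phi₁_phi₁ (f s : ℤ) (x : ℤ × ℤ × ℤ) : phi₁ f s (phi₁ f s x) = x := by
  simp [phi₁]

theorem phi₂_phi₂ (f s : ℤ) (x : ℤ × ℤ × ℤ) : phi₂ f s (phi₂ f s x) = x := by
  simp [phi₂]

theorem phi₃_phi₃ (s : ℤ) (x : ℤ × ℤ × ℤ) : phi₃ s (phi₃ s x) = x := by
  simp [phi₃]

/-- The image of a triple under the map among `φ₁, φ₂, φ₃` that makes it smaller, if any. -/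
def parent (f s : ℤ) (x : ℤ × ℤ × ℤ) : ℤ × ℤ × ℤ :=
  if f * s * x.2.1 * x.2.2 < 2 * x.1 then phi₁ f s x
  else if f * s * x.1 * x.2.2 < 2 * x.2.1 then phi₂ f s x
  else if s * x.1 * x.2.1 < 2 * x.2.2 then phi₃ s x
  else x

theorem parent_eq_phi₁ {f s : ℤ} {x : ℤ × ℤ × ℤ} (h : f * s * x.2.1 * x.2.2 < 2 * x.1) :
    parent f s x = phi₁ f s x := if_pos h

/-- The order of the tests in `parent` is immaterial: an involution lowers its coordinate exactly
when the matching term among `m²`, `n²`, `f q²` exceeds half of their sum `f s m n q`, and two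
positive terms cannot both do so when the third is positive. -/
theorem parent_eq_phi₂ {f s : ℤ} (hf : 0 < f) {x : ℤ × ℤ × ℤ} (hx : x ∈ solutions f s)
    (h : f * s * x.1 * x.2.2 < 2 * x.2.1) : parent f s x = phi₂ f s x := by
  obtain ⟨m, n, q⟩ := x
  obtain ⟨hm, hn, hq, he⟩ := hx
  simp only at hm hn hq he h
  rw [parent, if_neg, if_pos h]
  intro h'
  simp only at h'
  have h1 := mul_lt_mul_of_pos_left h hn
  have h2 := mul_lt_mul_of_pos_left h' hm
  have h3 : 0 < f * q ^ 2 := by positivity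
  linarith

theorem parent_eq_phi₃ {f s : ℤ} (hf : 0 < f) {x : ℤ × ℤ × ℤ} (hx : x ∈ solutions f s)
    (h : s * x.1 * x.2.1 < 2 * x.2.2) : parent f s x = phi₃ s x := by
  obtain ⟨m, n, q⟩ := x
  obtain ⟨hm, hn, hq, he⟩ := hx
  simp only at hm hn hq he h
  have h1 := mul_lt_mul_of_pos_left h (mul_pos hf hq)
  have h3 : 0 < m ^ 2 := by positivity
  have h4 : 0 < n ^ 2 := by positivity
  rw [parent, if_neg, if_neg, if_pos h]
  · intro h'
    simp only at h'
    have h2 := mul_lt_mul_of_pos_left h' hn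
    linarith
  · intro h'
    simp only at h'
    have h2 := mul_lt_mul_of_pos_left h' hm
    linarith

theorem parent_eq_self {f s : ℤ} {x : ℤ × ℤ × ℤ} (h1 : 2 * x.1 ≤ f * s * x.2.1 * x.2.2)
    (h2 : 2 * x.2.1 ≤ f * s * x.1 * x.2.2) (h3 : 2 * x.2.2 ≤ s * x.1 * x.2.1) :
    parent f s x = x := by
  rw [parent, if_neg h1.not_gt, if_neg h2.not_gt, if_neg h3.not_gt]

theorem parent_cases {f s : ℤ} (hf : 0 < f) {x : ℤ × ℤ × ℤ} (hx : x ∈ solutions f s) :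
    (f * s * x.2.1 * x.2.2 < 2 * x.1 ∧ parent f s x = phi₁ f s x) ∨
    (f * s * x.1 * x.2.2 < 2 * x.2.1 ∧ parent f s x = phi₂ f s x) ∨
    (s * x.1 * x.2.1 < 2 * x.2.2 ∧ parent f s x = phi₃ s x) ∨
    (2 * x.1 ≤ f * s * x.2.1 * x.2.2 ∧ 2 * x.2.1 ≤ f * s * x.1 * x.2.2 ∧
      2 * x.2.2 ≤ s * x.1 * x.2.1 ∧ parent f s x = x) := by
  by_cases h1 : f * s * x.2.1 * x.2.2 < 2 * x.1
  · exact Or.inl ⟨h1, parent_eq_phi₁ h1⟩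
  by_cases h2 : f * s * x.1 * x.2.2 < 2 * x.2.1
  · exact Or.inr (Or.inl ⟨h2, parent_eq_phi₂ hf hx h2⟩)
  by_cases h3 : s * x.1 * x.2.1 < 2 * x.2.2
  · exact Or.inr (Or.inr (Or.inl ⟨h3, parent_eq_phi₃ hf hx h3⟩))
  rw [not_lt] at h1 h2 h3
  exact Or.inr (Or.inr (Or.inr ⟨h1, h2, h3, parent_eq_self h1 h2 h3⟩))

theorem parent_mem {f s : ℤ} (hf : 0 < f) {x : ℤ × ℤ × ℤ} (hx : x ∈ solutions f s) :
    parent f s x ∈ solutions f s := by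
  rcases parent_cases hf hx with h | h | h | h
  · rw [h.2]; exact phi₁_mapsTo hf hx
  · rw [h.2]; exact phi₂_mapsTo hf hx
  · rw [h.2]; exact phi₃_mapsTo hf hx
  · rw [h.2.2.2]; exact hx

/-- The sum of the entries of a triple. -/
def height (x : ℤ × ℤ × ℤ) : ℕ := (x.1 + x.2.1 + x.2.2).toNat

theorem height_parent_lt {f s : ℤ} (hf : 0 < f) {x : ℤ × ℤ × ℤ} (hx : x ∈ solutions f s)
    (hne : parent f s x ≠ x) : height (parent f s x) < height x := by
  have hpos : 0 < x.1 + x.2.1 + x.2.2 := by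
    have h1 := hx.1
    have h2 := hx.2.1
    have h3 := hx.2.2.1
    omega
  refine (Int.toNat_lt_toNat hpos).2 ?_
  rcases parent_cases hf hx with h | h | h | h
  · rw [h.2]; simp only [phi₁]; linarith [h.1]
  · rw [h.2]; simp only [phi₂]; linarith [h.1]
  · rw [h.2]; simp only [phi₃]; linarith [h.1]
  · exact absurd h.2.2.2 hne

theorem solution_induction {f s : ℤ} (hf : 0 < f) {P : ℤ × ℤ × ℤ → Prop}
    (base : ∀ x ∈ solutions f s, parent f s x = x → P x)
    (h₁ : ∀ x ∈ solutions f s, P (phi₁ f s x) → P x)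
    (h₂ : ∀ x ∈ solutions f s, P (phi₂ f s x) → P x)
    (h₃ : ∀ x ∈ solutions f s, P (phi₃ s x) → P x) :
    ∀ x ∈ solutions f s, P x := by
  intro x
  induction hn : height x using Nat.strong_induction_on generalizing x with
  | _ n ih =>
    intro hx
    by_cases hp : parent f s x = x
    · exact base x hx hp
    have hP := ih _ (hn ▸ height_parent_lt hf hx hp) _ rfl (parent_mem hf hx)
    rcases parent_cases hf hx with h | h | h | h
    · exact h₁ x hx (h.2 ▸ hP)
    · exact h₂ x hx (h.2 ▸ hP)
    · exact h₃ x hx (h.2 ▸ hP)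
    · exact absurd h.2.2.2 hp

/-- An involution either fixes `x`, lowers it, or raises it; in the last case it lowers the image
back to `x`. This is what turns edges into parent relations. -/
theorem parent_phi₁ {f s : ℤ} {x : ℤ × ℤ × ℤ} :
    phi₁ f s x = x ∨ parent f s x = phi₁ f s x ∨ parent f s (phi₁ f s x) = x := by
  rcases lt_trichotomy (f * s * x.2.1 * x.2.2) (2 * x.1) with h | h | h
  · exact Or.inr (Or.inl (parent_eq_phi₁ h))
  · left
    ext
    · simp only [phi₁]; linarith
    · rfl
    · rfl
  · right; right
    rw [parent_eq_phi₁, phi₁_phi₁]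
    simp only [phi₁]; linarith

theorem parent_phi₂ {f s : ℤ} (hf : 0 < f) {x : ℤ × ℤ × ℤ} (hx : x ∈ solutions f s) :
    phi₂ f s x = x ∨ parent f s x = phi₂ f s x ∨ parent f s (phi₂ f s x) = x := by
  rcases lt_trichotomy (f * s * x.1 * x.2.2) (2 * x.2.1) with h | h | h
  · exact Or.inr (Or.inl (parent_eq_phi₂ hf hx h))
  · left
    ext
    · rfl
    · simp only [phi₂]; linarith
    · rfl
  · right; right
    rw [parent_eq_phi₂ hf (phi₂_mapsTo hf hx), phi₂_phi₂]
    simp only [phi₂]; linarith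

theorem parent_phi₃ {f s : ℤ} (hf : 0 < f) {x : ℤ × ℤ × ℤ} (hx : x ∈ solutions f s) :
    phi₃ s x = x ∨ parent f s x = phi₃ s x ∨ parent f s (phi₃ s x) = x := by
  rcases lt_trichotomy (s * x.1 * x.2.1) (2 * x.2.2) with h | h | h
  · exact Or.inr (Or.inl (parent_eq_phi₃ hf hx h))
  · left
    ext
    · rfl
    · rfl
    · simp only [phi₃]; linarith
  · right; right
    rw [parent_eq_phi₃ hf (phi₃_mapsTo hf hx), phi₃_phi₃]
    simp only [phi₃]; linarith

/-- The swap on integer triples. -/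
def swapTriple (x : ℤ × ℤ × ℤ) : ℤ × ℤ × ℤ := (x.2.1, x.1, x.2.2)

theorem swap_swap {f s : ℤ} (x : solutions f s) : swap (swap x) = x := rfl

theorem phi₁_swapTriple (f s : ℤ) (x : ℤ × ℤ × ℤ) :
    phi₁ f s (swapTriple x) = swapTriple (phi₂ f s x) := rfl

theorem phi₂_swapTriple (f s : ℤ) (x : ℤ × ℤ × ℤ) :
    phi₂ f s (swapTriple x) = swapTriple (phi₁ f s x) := rfl

theorem phi₃_swapTriple (s : ℤ) (x : ℤ × ℤ × ℤ) :
    phi₃ s (swapTriple x) = swapTriple (phi₃ s x) := by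
  simp only [phi₃, swapTriple]
  rw [mul_right_comm]

theorem parent_swapTriple {f s : ℤ} (hf : 0 < f) {x : ℤ × ℤ × ℤ} (hx : x ∈ solutions f s) :
    parent f s (swapTriple x) = swapTriple (parent f s x) := by
  have hx' : swapTriple x ∈ solutions f s := (swap ⟨x, hx⟩).2
  rcases parent_cases hf hx with h | h | h | h
  · rw [h.2, parent_eq_phi₂ hf hx' h.1, phi₂_swapTriple]
  · rw [h.2, parent_eq_phi₁ h.1, phi₁_swapTriple]
  · rw [h.2, parent_eq_phi₃ hf hx', phi₃_swapTriple]
    simp only [swapTriple]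
    rw [mul_right_comm]
    exact h.1
  · rw [h.2.2.2, parent_eq_self]
    · exact h.2.1
    · exact h.1
    · simp only [swapTriple]
      rw [mul_right_comm]
      exact h.2.2.1

/-! ## The roots -/

/-- From `C ≤ A + B ≤ 2 B` follows `K ≤ 4 B`, so `c A B C = K² ≤ 16 B² ≤ 16 B C`. It is applied to
`m²`, `n²`, `f q²` with `c = f s²`, and bounds the smallest term of a solution that no involution
lowers. -/
theorem mul_le_of_sorted {A B C K c : ℤ} (hA : 0 < A) (hB : 0 < B) (hAB : A ≤ B) (hBC : B ≤ C)
    (hsum : A + B + C = K) (hC : 2 * C ≤ K) (hK : K ^ 2 = c * A * B * C) : c * A ≤ 16 := by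
  have h1 : K ≤ 4 * B := by linarith
  have hK0 : 0 ≤ K := by linarith
  have h2 : K ^ 2 ≤ (4 * B) ^ 2 := pow_le_pow_left₀ hK0 h1 2
  have h3 : B * B ≤ B * C := mul_le_mul_of_nonneg_left hBC hB.le
  have h4 : (B * C) * (c * A) ≤ (B * C) * 16 := by
    calc (B * C) * (c * A) = K ^ 2 := by rw [hK]; ring
      _ ≤ (4 * B) ^ 2 := h2
      _ = 16 * (B * B) := by ring
      _ ≤ 16 * (B * C) := by linarith
      _ = _ := by ring
  exact le_of_mul_le_mul_left h4 (mul_pos hB (hB.trans_le hBC))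

theorem exists_mul_le {A B C K c : ℤ} (hA : 0 < A) (hB : 0 < B) (hC : 0 < C)
    (hsum : A + B + C = K) (hAK : 2 * A ≤ K) (hBK : 2 * B ≤ K) (hCK : 2 * C ≤ K)
    (hK : K ^ 2 = c * A * B * C) : c * A ≤ 16 ∨ c * B ≤ 16 ∨ c * C ≤ 16 := by
  rcases le_total A B with h1 | h1 <;> rcases le_total B C with h2 | h2 <;>
    rcases le_total A C with h3 | h3
  · exact Or.inl (mul_le_of_sorted (K := K) hA hB h1 h2 (by linarith) hCK (by linarith))
  · exact Or.inl (mul_le_of_sorted (K := K) hA hB h1 h2 (by linarith) hCK (by linarith))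
  · exact Or.inl (mul_le_of_sorted (K := K) hA hC h3 h2 (by linarith) hBK (by linarith))
  · exact Or.inr (Or.inr
      (mul_le_of_sorted (K := K) hC hA h3 h1 (by linarith) hBK (by linarith)))
  · exact Or.inr (Or.inl
      (mul_le_of_sorted (K := K) hB hA h1 h3 (by linarith) hCK (by linarith)))
  · exact Or.inr (Or.inl
      (mul_le_of_sorted (K := K) hB hC h2 h3 (by linarith) hAK (by linarith)))
  · exact Or.inr (Or.inr
      (mul_le_of_sorted (K := K) hC hB h2 h1 (by linarith) hAK (by linarith)))
  · exact Or.inr (Or.inr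
      (mul_le_of_sorted (K := K) hC hB h2 h1 (by linarith) hAK (by linarith)))

theorem eq_one_of_sq_le_three {a : ℤ} (h0 : 0 < a) (h : a ^ 2 ≤ 3) : a = 1 := by nlinarith

theorem root_markov_one {n q : ℤ} (hn : 0 < n) (hq : 0 < q) (h : 1 + n ^ 2 + q ^ 2 = 3 * n * q)
    (h1 : 2 * n ≤ 3 * q) (h2 : 2 * q ≤ 3 * n) : n = 1 ∧ q = 1 := by
  wlog hnq : n ≤ q generalizing n q
  · exact (this hq hn (by linarith) h2 h1 (by linarith)).symm
  -- The product has the same mixed term `3 n q` as the equation; substituting cancels `q²` and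
  -- leaves `n² ≤ 1`. The products in the other cases below are chosen in the same way.
  have h3 : 0 ≤ (q - n) * (2 * n - q) := mul_nonneg (by linarith) (by linarith)
  have hn1 : n = 1 := eq_one_of_sq_le_three hn (by nlinarith)
  subst hn1
  exact ⟨rfl, by linarith⟩

theorem root_of_one {f s n q : ℤ} (ha : Admissible f s) (hn : 0 < n) (hq : 0 < q)
    (h : 1 + n ^ 2 + f * q ^ 2 = f * s * n * q)
    (h1 : 2 * n ≤ f * s * q) (h2 : 2 * q ≤ s * n) :
    (f = 5 ∧ n = 2 ∧ q = 1) ∨ (f ≠ 5 ∧ n = 1 ∧ q = 1) := by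
  rcases ha with ⟨rfl, rfl⟩ | ⟨rfl, rfl⟩ | ⟨rfl, rfl⟩
  · exact Or.inr ⟨by norm_num, root_markov_one hn hq (by linarith) (by linarith) (by linarith)⟩
  · have h3 : 0 ≤ (n - q) * (3 * q - n) := mul_nonneg (by linarith) (by linarith)
    have hq1 : q = 1 := eq_one_of_sq_le_three hq (by nlinarith)
    subst hq1
    have : n = 1 ∨ n = 2 := by omega
    rcases this with rfl | rfl
    · norm_num
    · norm_num at h
  · have h3 : 0 ≤ (n - 2 * q) * (3 * q - n) := mul_nonneg (by linarith) (by linarith)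
    have hq1 : q = 1 := eq_one_of_sq_le_three hq (by nlinarith)
    subst hq1
    have : n = 2 := by omega
    exact Or.inl ⟨rfl, this, rfl⟩

theorem eq_root_of_parent_eq_self {f s : ℤ} (ha : Admissible f s) {x : ℤ × ℤ × ℤ}
    (hx : x ∈ solutions f s) (hp : parent f s x = x) :
    (f = 5 ∧ (x = (1, 2, 1) ∨ x = (2, 1, 1))) ∨ (f ≠ 5 ∧ x = (1, 1, 1)) := by
  have hf := ha.f_pos
  have hs := ha.s_pos
  have hle : 2 * x.1 ≤ f * s * x.2.1 * x.2.2 ∧ 2 * x.2.1 ≤ f * s * x.1 * x.2.2 ∧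
      2 * x.2.2 ≤ s * x.1 * x.2.1 := by
    rcases parent_cases hf hx with h | h | h | h
    · have := congrArg Prod.fst (hp.symm.trans h.2)
      simp only [phi₁] at this
      linarith [h.1]
    · have := congrArg (fun y => y.2.1) (hp.symm.trans h.2)
      simp only [phi₂] at this
      linarith [h.1]
    · have := congrArg (fun y => y.2.2) (hp.symm.trans h.2)
      simp only [phi₃] at this
      linarith [h.1]
    · exact ⟨h.1, h.2.1, h.2.2.1⟩
  obtain ⟨m, n, q⟩ := x
  obtain ⟨hm, hn, hq, he⟩ := hx
  simp only at hm hn hq he hle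
  obtain ⟨h1, h2, h3⟩ := hle
  have caseM : m = 1 → (f = 5 ∧ (m, n, q) = (1, 2, 1)) ∨ (f ≠ 5 ∧ (m, n, q) = (1, 1, 1)) := by
    rintro rfl
    rcases root_of_one ha hn hq (by linarith) (by linarith) (by linarith) with
      ⟨h, rfl, rfl⟩ | ⟨h, rfl, rfl⟩
    · exact Or.inl ⟨h, rfl⟩
    · exact Or.inr ⟨h, rfl⟩
  have caseN : n = 1 → (f = 5 ∧ (m, n, q) = (2, 1, 1)) ∨ (f ≠ 5 ∧ (m, n, q) = (1, 1, 1)) := by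
    rintro rfl
    rcases root_of_one ha hm hq (by linarith) (by linarith) (by linarith) with
      ⟨h, rfl, rfl⟩ | ⟨h, rfl, rfl⟩
    · exact Or.inl ⟨h, rfl⟩
    · exact Or.inr ⟨h, rfl⟩
  have hmn : m = 1 ∨ n = 1 := by
    -- Here `c` is 9, 8 or 5, so one of the three terms is at most 1, 2 or 3 respectively.
    have h4 := exists_mul_le (c := f * s ^ 2) (A := m ^ 2) (B := n ^ 2) (C := f * q ^ 2)
      (by positivity) (by positivity) (by positivity) he
      (by linarith [mul_le_mul_of_nonneg_left h1 hm.le])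
      (by linarith [mul_le_mul_of_nonneg_left h2 hn.le])
      (by linarith [mul_le_mul_of_nonneg_left h3 (mul_pos hf hq).le])
      (by ring)
    rcases ha with ⟨rfl, rfl⟩ | ⟨rfl, rfl⟩ | ⟨rfl, rfl⟩
    · rcases h4 with h4 | h4 | h4
      · exact Or.inl (eq_one_of_sq_le_three hm (by linarith))
      · exact Or.inr (eq_one_of_sq_le_three hn (by linarith))
      · have hq1 : q = 1 := eq_one_of_sq_le_three hq (by linarith)
        subst hq1
        exact Or.inl (root_markov_one hm hn (by linarith) (by linarith) (by linarith)).1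
    · rcases h4 with h4 | h4 | h4
      · exact Or.inl (eq_one_of_sq_le_three hm (by linarith))
      · exact Or.inr (eq_one_of_sq_le_three hn (by linarith))
      · have hq1 : q = 1 := eq_one_of_sq_le_three hq (by linarith)
        subst hq1
        rcases le_total m n with hmn | hmn
        · have h5 : 0 ≤ (n - m) * (3 * m - n) := mul_nonneg (by linarith) (by linarith)
          exact Or.inl (eq_one_of_sq_le_three hm (by nlinarith))
        · have h5 : 0 ≤ (m - n) * (3 * n - m) := mul_nonneg (by linarith) (by linarith)
          exact Or.inr (eq_one_of_sq_le_three hn (by nlinarith))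
    · rcases h4 with h4 | h4 | h4
      · exact Or.inl (eq_one_of_sq_le_three hm (by linarith))
      · exact Or.inr (eq_one_of_sq_le_three hn (by linarith))
      · have := sq_pos_of_pos hq
        linarith
  rcases hmn with h | h
  · rcases caseM h with h | h
    · exact Or.inl ⟨h.1, Or.inl h.2⟩
    · exact Or.inr h
  · rcases caseN h with h | h
    · exact Or.inl ⟨h.1, Or.inr h.2⟩
    · exact Or.inr h

/-- The roots have `q = 1`. Modulo `q`, the maps `φ₁` and `φ₂` only change the sign of `s m n`,
while `φ₃` replaces `q` by `s m n - q`, so coprimality propagates through the trees. It makes the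
gcd of the sides equal to `f s`. -/
theorem isCoprime_of_mem {f s : ℤ} (ha : Admissible f s) :
    ∀ x ∈ solutions f s, IsCoprime x.2.2 (s * x.1 * x.2.1) := by
  refine solution_induction ha.f_pos ?_ ?_ ?_ ?_
  · intro x hx hp
    have : x.2.2 = 1 := by
      rcases eq_root_of_parent_eq_self ha hx hp with ⟨_, rfl | rfl⟩ | ⟨_, rfl⟩ <;> rfl
    rw [this]
    exact isCoprime_one_left
  · rintro ⟨m, n, q⟩ _ h
    simp only [phi₁] at h ⊢
    rw [show s * m * n = -(s * (f * s * n * q - m) * n + q * (-(s * n * (f * s * n)))) by ring]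
    exact (IsCoprime.add_mul_left_right h _).neg_right
  · rintro ⟨m, n, q⟩ _ h
    simp only [phi₂] at h ⊢
    rw [show s * m * n = -(s * m * (f * s * m * q - n) + q * (-(s * m * (f * s * m)))) by ring]
    exact (IsCoprime.add_mul_left_right h _).neg_right
  · rintro ⟨m, n, q⟩ _ h
    simp only [phi₃] at h ⊢
    have h1 := (IsCoprime.add_mul_left_left h (-1)).neg_left
    rwa [show -(s * m * n - q + s * m * n * (-1)) = q by ring] at h1

/-! ## Side pairs come from solutions -/

/-- The same descent, with `k` bounding the sum of the entries: a solution that cannot be lowered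
would have a square `A ≥ 1` with `25 A ≤ 16`. -/
theorem not_hurwitz_five (k : ℕ) : ∀ m n q : ℤ, 0 < m → 0 < n → 0 < q → m + n + q ≤ k →
    m ^ 2 + n ^ 2 + q ^ 2 ≠ 5 * m * n * q := by
  have aux : ∀ m n q : ℤ, 0 < m → 0 < n → 0 < q → m ^ 2 + n ^ 2 + q ^ 2 = 5 * m * n * q →
      0 < 5 * n * q - m := by
    intro m n q hm hn hq h
    refine (mul_pos_iff_of_pos_left hm).1 ?_
    have : m * (5 * n * q - m) = n ^ 2 + q ^ 2 := by linear_combination -h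
    rw [this]
    positivity
  induction k with
  | zero => intro m n q hm hn hq hk; norm_num at hk; linarith
  | succ k ih =>
    intro m n q hm hn hq hk h
    push_cast at hk
    by_cases h1 : 5 * n * q < 2 * m
    · exact ih (5 * n * q - m) n q (aux m n q hm hn hq h) hn hq (by linarith)
        (by linear_combination h)
    by_cases h2 : 5 * m * q < 2 * n
    · exact ih m (5 * m * q - n) q hm (aux n m q hn hm hq (by linarith)) hq (by linarith)
        (by linear_combination h)
    by_cases h3 : 5 * m * n < 2 * q
    · exact ih m n (5 * m * n - q) hm hn
        (by linarith [aux q m n hq hm hn (by linarith)]) (by linarith)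
        (by linear_combination h)
    rw [not_lt] at h1 h2 h3
    have := sq_pos_of_pos hm
    have := sq_pos_of_pos hn
    have := sq_pos_of_pos hq
    rcases exists_mul_le (c := 25) (A := m ^ 2) (B := n ^ 2) (C := q ^ 2)
      (by positivity) (by positivity) (by positivity) h
      (by linarith [mul_le_mul_of_nonneg_left h1 hm.le])
      (by linarith [mul_le_mul_of_nonneg_left h2 hn.le])
      (by linarith [mul_le_mul_of_nonneg_left h3 hq.le])
      (by ring) with h4 | h4 | h4 <;> linarith

/-- With `e` the gcd, the cofactors are coprime with square product, hence squares. The case `y = 0`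
does occur: it is the case of zero discriminant, as for the sides `(4, 4)`. -/
theorem exists_eq_mul_sq {X Y k : ℤ} (hX : 0 < X) (hXY : X * Y = k ^ 2) :
    ∃ e x y : ℤ, 0 < e ∧ 0 < x ∧ 0 ≤ y ∧ X = e * x ^ 2 ∧ Y = e * y ^ 2 := by
  have hg : 0 < Int.gcd X Y := Int.gcd_pos_of_ne_zero_left _ hX.ne'
  obtain ⟨X', Y', hc, hX', hY'⟩ := Int.exists_gcd_one hg
  set e : ℤ := (Int.gcd X Y : ℤ) with he
  have he0 : 0 < e := Int.natCast_pos.2 hg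
  have hc' : IsCoprime X' Y' := Int.isCoprime_iff_gcd_eq_one.2 hc
  have hXp : 0 < X' := by
    rw [hX'] at hX
    exact (mul_pos_iff_of_pos_right he0).1 hX
  have hY0 : 0 ≤ Y' := by
    have h1 : 0 ≤ X * Y := hXY ▸ sq_nonneg k
    rw [hX', hY'] at h1
    have h2 : 0 ≤ (X' * e * e) * Y' := by linarith
    exact nonneg_of_mul_nonneg_right h2 (by positivity)
  obtain ⟨k', rfl⟩ : e ∣ k := by
    rw [← Int.pow_dvd_pow_iff two_ne_zero, ← hXY]
    exact ⟨X' * Y', by rw [hX', hY']; ring⟩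
  have hk : X' * Y' = k' ^ 2 := by
    refine mul_left_cancel₀ (pow_ne_zero 2 he0.ne') ?_
    rw [← mul_pow, ← hXY, hX', hY']; ring
  have sq : ∀ Z : ℤ, 0 ≤ Z → (∃ z, Z = z ^ 2 ∨ Z = -z ^ 2) → ∃ z, 0 ≤ z ∧ Z = z ^ 2 := by
    rintro Z hZ ⟨z, h | h⟩
    · exact ⟨|z|, abs_nonneg z, by rw [h, sq_abs]⟩
    · exact ⟨0, le_rfl, by nlinarith [sq_nonneg z]⟩
  obtain ⟨x, hx0, hx⟩ := sq X' hXp.le (Int.sq_of_isCoprime hc' hk)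
  obtain ⟨y, hy0, hy⟩ := sq Y' hY0 (Int.sq_of_isCoprime hc'.symm (by rw [mul_comm]; exact hk))
  refine ⟨e, x, y, he0, hx0.lt_of_ne ?_, hy0, by rw [hX', hx, mul_comm], by rw [hY', hy, mul_comm]⟩
  rintro rfl
  norm_num at hx
  omega

theorem sq_emod_four (x : ℤ) : x ^ 2 % 4 = 0 ∨ x ^ 2 % 4 = 1 := by
  have : x % 4 = 0 ∨ x % 4 = 1 ∨ x % 4 = 2 ∨ x % 4 = 3 := by omega
  rcases this with h | h | h | h <;> simp [pow_two, Int.mul_emod, h]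

theorem sq_emod_eight (x : ℤ) : x ^ 2 % 8 = 0 ∨ x ^ 2 % 8 = 1 ∨ x ^ 2 % 8 = 4 := by
  have : x % 8 = 0 ∨ x % 8 = 1 ∨ x % 8 = 2 ∨ x % 8 = 3 ∨ x % 8 = 4 ∨ x % 8 = 5 ∨ x % 8 = 6 ∨
    x % 8 = 7 := by omega
  rcases this with h | h | h | h | h | h | h | h <;> simp [pow_two, Int.mul_emod, h]

theorem nine_dvd_of_three_dvd_sq_add_sq {x y : ℤ} (h : (3 : ℤ) ∣ x ^ 2 + y ^ 2) :
    (9 : ℤ) ∣ x ^ 2 ∧ (9 : ℤ) ∣ y ^ 2 := by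
  have sq : ∀ z : ℤ, z ^ 2 % 3 = 1 ∨ (9 : ℤ) ∣ z ^ 2 := by
    intro z
    have : z % 3 = 0 ∨ z % 3 = 1 ∨ z % 3 = 2 := by omega
    rcases this with h | h | h
    · right
      obtain ⟨w, rfl⟩ := Int.dvd_of_emod_eq_zero h
      exact ⟨w ^ 2, by ring⟩
    · left; simp [pow_two, Int.mul_emod, h]
    · left; simp [pow_two, Int.mul_emod, h]
  rcases sq x with h1 | h1 <;> rcases sq y with h2 | h2
  · omega
  · omega
  · omega
  · exact ⟨h1, h2⟩

/-- The witnesses are `(x + y) / 2` and `(x - y) / 2`; they are integers because `x² + y²` is even.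
-/
theorem exists_mul_eq_of_sq {x y t w : ℤ} (hx : 0 < x) (hy : 0 ≤ y) (ht : 0 < t)
    (h1 : x ^ 2 - y ^ 2 = 4 * t) (h2 : x ^ 2 + y ^ 2 = 2 * w) :
    ∃ m n : ℤ, 0 < m ∧ 0 < n ∧ m * n = t ∧ m ^ 2 + n ^ 2 = w := by
  have hyx : y < x := by
    by_contra! h
    nlinarith
  have hpar : (2 : ℤ) ∣ x + y := by
    have : (2 : ℤ) ∣ (x + y) ^ 2 := ⟨w + x * y, by linear_combination h2⟩
    exact Int.prime_two.dvd_of_dvd_pow this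
  obtain ⟨m, hm⟩ := hpar
  refine ⟨m, x - m, by linarith, by linarith, ?_, ?_⟩
  · have : y = 2 * m - x := by linarith
    subst this
    linarith
  · have : y = 2 * m - x := by linarith
    subst this
    linarith

theorem not_dvd_of_isCoprime {S P : ℤ} (h : IsCoprime S P) {p : ℤ} (hp : 1 < p) (hS : p ∣ S)
    (hP : p ∣ P) : False := by
  rcases Int.isUnit_iff.1 (h.isUnit_of_dvd' hS hP) with h1 | h1 <;> omega

theorem exists_of_three {e x y S P : ℤ} (he : e ∣ 12) (he0 : 0 < e) (hx : 0 < x) (hy : 0 ≤ y)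
    (hS : 0 < S) (hc : IsCoprime S P) (h1 : e * x ^ 2 - e * y ^ 2 = 4 * S)
    (h2 : e * x ^ 2 + e * y ^ 2 = 6 * P) :
    ∃ m n : ℤ, 0 < m ∧ 0 < n ∧ 3 * (m * n) = S ∧ m ^ 2 + n ^ 2 = P := by
  have hx4 := sq_emod_four x
  have hy4 := sq_emod_four y
  -- If 3 divides `x² + y²`, then it divides both `x` and `y`, so 9 divides `4 S` and `6 P`, against
  -- coprimality. This excludes `e = 1, 2, 4`; for `e = 6` both `S` and `P` are even; `e = 3` and `e
  -- = 12` give the solution.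
  have bad : (3 : ℤ) ∣ x ^ 2 + y ^ 2 → False := fun h => by
    obtain ⟨⟨X, hX⟩, Y, hY⟩ := nine_dvd_of_three_dvd_sq_add_sq h
    rw [hX, hY] at h1 h2
    refine not_dvd_of_isCoprime (p := 3) hc (by norm_num) ?_ ?_
    · have : (3 : ℤ) ∣ 4 * S := ⟨3 * (e * X - e * Y), by linear_combination -h1⟩
      omega
    · have : (9 : ℤ) ∣ 6 * P := ⟨e * X + e * Y, by linear_combination -h2⟩
      omega
  have hle := Int.le_of_dvd (by norm_num) he
  interval_cases e <;> try omega
  · exact (bad (by omega)).elim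
  · exact (bad (by omega)).elim
  · obtain ⟨t, rfl⟩ : (3 : ℤ) ∣ S := by omega
    obtain ⟨m, n, hm, hn, h3, h4⟩ := exists_mul_eq_of_sq (t := t) (w := P) hx hy (by omega)
      (by omega) (by omega)
    exact ⟨m, n, hm, hn, by rw [h3], h4⟩
  · exact (bad (by omega)).elim
  · exact (not_dvd_of_isCoprime (p := 2) hc (by norm_num) (by omega) (by omega)).elim
  · obtain ⟨t, rfl⟩ : (3 : ℤ) ∣ S := by omega
    obtain ⟨m, n, hm, hn, h3, h4⟩ := exists_mul_eq_of_sq (x := 2 * x) (y := 2 * y) (t := t)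
      (w := P) (by omega) (by omega) (by omega) (by linarith) (by linarith)
    exact ⟨m, n, hm, hn, by rw [h3], h4⟩

theorem exists_of_four {e x y q q' : ℤ} (he : e ∣ 16) (he0 : 0 < e) (hx : 0 < x) (hy : 0 ≤ y)
    (hS : 0 < q + q') (hc : IsCoprime (q + q') (q * q'))
    (h1 : e * x ^ 2 - e * y ^ 2 = 4 * (q + q')) (h2 : e * x ^ 2 + e * y ^ 2 = 8 * (q * q')) :
    ∃ m n : ℤ, 0 < m ∧ 0 < n ∧ 2 * (m * n) = q + q' ∧ m ^ 2 + n ^ 2 = 2 * (q * q') := by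
  -- Here `q + q'` is even, so `q q'` is odd, and then so are `x` and `y`. Hence `q' ≡ -q` mod 8 and
  -- `q q' ≡ -1` mod 8, whereas `x² + y² ≡ 2` mod 8 gives `q q' ≡ 1` mod 4. This excludes `e = 1`
  -- and `e = 4`.
  have bad : ∀ x y : ℤ, x ^ 2 - y ^ 2 = q + q' → x ^ 2 + y ^ 2 = 2 * (q * q') → False := by
    intro x y h1 h2
    have hx4 := sq_emod_eight x
    have hy4 := sq_emod_eight y
    have hq4 := sq_emod_eight q
    by_cases hP : (2 : ℤ) ∣ q * q'
    · exact not_dvd_of_isCoprime (p := 2) hc (by norm_num) (by omega) hP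
    · obtain ⟨k, hk⟩ : (8 : ℤ) ∣ q + q' := by omega
      have h3 : q * q' + q ^ 2 = 8 * (q * k) := by linear_combination q * hk
      omega
  have hx4 := sq_emod_four x
  have hy4 := sq_emod_four y
  have hle := Int.le_of_dvd (by norm_num) he
  have ev : ∀ z : ℤ, z ^ 2 % 4 = 0 → ∃ w, z = 2 * w := by
    intro z hz
    exact Int.prime_two.dvd_of_dvd_pow (by omega : (2 : ℤ) ∣ z ^ 2)
  interval_cases e <;> try omega
  · obtain ⟨x, rfl⟩ := ev x (by omega)
    obtain ⟨y, rfl⟩ := ev y (by omega)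
    exact (bad x y (by linarith) (by linarith)).elim
  · obtain ⟨t, ht⟩ : (2 : ℤ) ∣ q + q' := by omega
    obtain ⟨m, n, hm, hn, h3, h4⟩ := exists_mul_eq_of_sq (t := t) (w := 2 * (q * q')) hx hy
      (by omega) (by omega) (by omega)
    exact ⟨m, n, hm, hn, by rw [h3, ht], h4⟩
  · exact (bad x y (by omega) (by omega)).elim
  · obtain ⟨m, n, hm, hn, h3, h4⟩ := exists_mul_eq_of_sq (x := 2 * x) (y := 2 * y)
      (t := x ^ 2 - y ^ 2) (w := 2 * (q * q')) (by omega) (by omega) (by omega) (by ring)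
      (by linarith)
    exact ⟨m, n, hm, hn, by rw [h3]; omega, h4⟩
  · exact (not_dvd_of_isCoprime (p := 2) hc (by norm_num) (by omega) (by omega)).elim

theorem exists_of_five {e x y q q' : ℤ} (he : e ∣ 20) (he0 : 0 < e) (hx : 0 < x) (hy : 0 ≤ y)
    (hq : 0 < q) (hS : 0 < q + q') (hc : IsCoprime (q + q') (q * q'))
    (h1 : e * x ^ 2 - e * y ^ 2 = 4 * (q + q')) (h2 : e * x ^ 2 + e * y ^ 2 = 10 * (q * q')) :
    ∃ m n : ℤ, 0 < m ∧ 0 < n ∧ m * n = q + q' ∧ m ^ 2 + n ^ 2 = 5 * (q * q') := by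
  -- In these cases (`e = 5` and `e = 20`) one gets `5 m n = q + q'` and `m² + n² = q q'`, hence `m²
  -- + n² + q² = 5 m n q`, which has no positive solution. No congruence is used to exclude it.
  have bad : ∀ x y : ℤ, 0 < x → 0 ≤ y → 5 * (x ^ 2 - y ^ 2) = 4 * (q + q') →
      x ^ 2 + y ^ 2 = 2 * (q * q') → False := by
    intro x y hx hy h1 h2
    obtain ⟨t, ht⟩ : (5 : ℤ) ∣ q + q' := by omega
    obtain ⟨m, n, hm, hn, h3, h4⟩ := exists_mul_eq_of_sq (t := t) (w := q * q') hx hy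
      (by omega) (by omega) (by omega)
    refine not_hurwitz_five (m + n + q).toNat m n q hm hn hq (Int.self_le_toNat _) ?_
    linear_combination h4 - q * ht * (-1) - 5 * q * h3
  have hx4 := sq_emod_four x
  have hy4 := sq_emod_four y
  have hle := Int.le_of_dvd (by norm_num) he
  interval_cases e <;> try omega
  · exact exists_mul_eq_of_sq hx hy hS (by linarith) (by linarith)
  · exact (not_dvd_of_isCoprime (p := 2) hc (by norm_num) (by omega) (by omega)).elim
  · exact exists_mul_eq_of_sq (x := 2 * x) (y := 2 * y) (by omega) (by omega) hS
      (by linarith) (by linarith)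
  · exact (bad x y hx hy (by linarith) (by linarith)).elim
  · exact (not_dvd_of_isCoprime (p := 2) hc (by norm_num) (by omega) (by omega)).elim
  · exact (bad (2 * x) (2 * y) (by omega) (by omega) (by linarith) (by linarith)).elim

theorem exists_solution {f s q q' k : ℤ} (ha : Admissible f s) (hq : 0 < q) (hq' : 0 < q')
    (hc : IsCoprime q q') (hk : (f * s) ^ 2 * (q * q') ^ 2 - 4 * (q + q') ^ 2 = k ^ 2) :
    ∃ m n : ℤ, (m, n, q) ∈ solutions f s ∧ s * m * n - q = q' := by
  have hf := ha.f_pos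
  have hs := ha.s_pos
  have hc' : IsCoprime (q + q') (q * q') := by
    refine IsCoprime.mul_right ?_ ?_
    · simpa [add_comm] using (IsCoprime.add_mul_left_left hc.symm 1)
    · simpa using (IsCoprime.add_mul_left_left hc 1)
  have hS : 0 < q + q' := by positivity
  obtain ⟨e, x, y, he, hx, hy, hX, hY⟩ := exists_eq_mul_sq
    (X := f * s * (q * q') + 2 * (q + q')) (Y := f * s * (q * q') - 2 * (q + q')) (k := k)
    (by positivity) (by rw [← hk]; ring)
  have h1 : e * x ^ 2 - e * y ^ 2 = 4 * (q + q') := by linarith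
  have h2 : e * x ^ 2 + e * y ^ 2 = 2 * (f * s) * (q * q') := by linarith
  -- Since `e` divides `4 (q + q')` and `2 f s q q'`, a Bézout relation between `q + q'` and `q q'`
  -- yields `4 f s`.
  have hdvd : e ∣ 4 * (f * s) := by
    obtain ⟨u, v, huv⟩ := hc'
    refine ⟨f * s * u * (x ^ 2 - y ^ 2) + 2 * v * (x ^ 2 + y ^ 2), ?_⟩
    linear_combination (-4 * (f * s)) * huv - f * s * u * h1 - 2 * v * h2
  suffices ∃ m n : ℤ, 0 < m ∧ 0 < n ∧ s * (m * n) = q + q' ∧ m ^ 2 + n ^ 2 = f * (q * q') by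
    obtain ⟨m, n, hm, hn, h3, h4⟩ := this
    refine ⟨m, n, ⟨hm, hn, hq, ?_⟩, by linarith⟩
    simp only
    linear_combination h4 - f * q * h3
  rcases ha with ⟨rfl, rfl⟩ | ⟨rfl, rfl⟩ | ⟨rfl, rfl⟩
  · simpa using exists_of_three hdvd he hx hy hS hc' h1 (by linarith)
  · exact exists_of_four hdvd he hx hy hS hc' h1 (by linarith)
  · simpa using exists_of_five hdvd he hx hy hq hS hc' h1 (by linarith)

/-! ## The map from solutions to side pairs -/

theorem sortPair_mk_comm {α : Type*} [LinearOrder α] (a b : α) :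
    sortPair (a, b) = sortPair (b, a) := by
  simp [sortPair, min_comm, max_comm]

theorem sortPair_of_le {α : Type*} [LinearOrder α] {a b : α} (h : a ≤ b) :
    sortPair (a, b) = (a, b) := by
  simp [sortPair, h]

theorem sortPair_mk_eq_iff {α : Type*} [LinearOrder α] {a b c d : α} :
    sortPair (a, b) = sortPair (c, d) ↔ (a = c ∧ b = d) ∨ (a = d ∧ b = c) := by
  constructor
  · intro h
    rcases le_total a b with h1 | h1 <;> rcases le_total c d with h2 | h2 <;>
      simp [sortPair, h1, h2] at h <;> tauto
  · rintro (⟨rfl, rfl⟩ | ⟨rfl, rfl⟩)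
    · rfl
    · exact sortPair_mk_comm _ _

theorem sidesOf_phi₃ (f s : ℤ) (x : ℤ × ℤ × ℤ) : sidesOf f s (phi₃ s x) = sidesOf f s x := by
  simp only [sidesOf, phi₃]
  rw [sortPair_mk_comm, sub_sub_cancel]

theorem sidesOf_swapTriple (f s : ℤ) (x : ℤ × ℤ × ℤ) :
    sidesOf f s (swapTriple x) = sidesOf f s x := by
  simp only [sidesOf, swapTriple]
  rw [mul_right_comm s]

theorem sidesOf_eq_iff {f s : ℤ} (hf : 0 < f) (hs : 0 < s) (x y : ℤ × ℤ × ℤ) :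
    sidesOf f s x = sidesOf f s y ↔
      (x.2.2 = y.2.2 ∧ s * x.1 * x.2.1 = s * y.1 * y.2.1) ∨
      (x.2.2 = s * y.1 * y.2.1 - y.2.2 ∧ s * x.1 * x.2.1 = s * y.1 * y.2.1) := by
  have h0 : f * s ≠ 0 := (mul_pos hf hs).ne'
  rw [sidesOf, sidesOf, sortPair_mk_eq_iff]
  simp only [mul_right_inj' h0]
  constructor
  · rintro (⟨h1, h2⟩ | ⟨h1, h2⟩)
    · exact Or.inl ⟨h1, by linarith⟩
    · exact Or.inr ⟨h1, by linarith⟩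
  · rintro (⟨h1, h2⟩ | ⟨h1, h2⟩)
    · exact Or.inl ⟨h1, by linarith⟩
    · exact Or.inr ⟨h1, by linarith⟩

theorem eq_or_eq_swapTriple {f s : ℤ} (hs : 0 < s) {x y : ℤ × ℤ × ℤ}
    (hx : x ∈ solutions f s) (hy : y ∈ solutions f s) (hq : x.2.2 = y.2.2)
    (hmn : s * x.1 * x.2.1 = s * y.1 * y.2.1) : y = x ∨ y = swapTriple x := by
  obtain ⟨m, n, q⟩ := x
  obtain ⟨m', n', q'⟩ := y
  obtain ⟨hm, hn, -, h⟩ := hx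
  obtain ⟨hm', hn', -, h'⟩ := hy
  simp only at hm hn h hm' hn' h' hq hmn
  subst hq
  have h1 : m * n = m' * n' := mul_left_cancel₀ hs.ne' (by linarith)
  have h2 : (m + n) ^ 2 = (m' + n') ^ 2 := by
    linear_combination h - h' + 2 * h1 + f * q * hmn
  have h3 : m + n = m' + n' := (pow_left_inj₀ (by positivity) (by positivity) two_ne_zero).1 h2
  -- Equal sums and products: `m'` is a root of `(T - m) (T - n)`.
  have h4 : (m' - m) * (m' - n) = 0 := by linear_combination h1 - m' * h3
  rcases mul_eq_zero.1 h4 with h5 | h5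
  · left
    ext
    · simp only; linarith
    · simp only; linarith
    · rfl
  · right
    ext
    · simp only [swapTriple]; linarith
    · simp only [swapTriple]; linarith
    · rfl

/-- The fibres of `sidesOf` are the orbits of `φ₃` and the swap. The sides give `q` up to `φ₃` and
the product `m n`; the equation then gives `m² + n²`. -/
theorem eq_of_sidesOf_eq {f s : ℤ} (hf : 0 < f) (hs : 0 < s) {x y : ℤ × ℤ × ℤ}
    (hx : x ∈ solutions f s) (hy : y ∈ solutions f s) (h : sidesOf f s x = sidesOf f s y) :
    y = x ∨ y = swapTriple x ∨ y = phi₃ s x ∨ y = swapTriple (phi₃ s x) := by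
  rcases (sidesOf_eq_iff hf hs x y).1 h with ⟨h1, h2⟩ | ⟨h1, h2⟩
  · rcases eq_or_eq_swapTriple hs hx hy h1 h2 with h3 | h3
    · exact Or.inl h3
    · exact Or.inr (Or.inl h3)
  · rcases eq_or_eq_swapTriple hs (phi₃_mapsTo hf hx) hy
      (by simp only [phi₃]; linarith) (by simp only [phi₃]; exact h2) with h3 | h3
    · exact Or.inr (Or.inr (Or.inl h3))
    · exact Or.inr (Or.inr (Or.inr h3))

theorem sidesOf_mem {g : ℕ} {f s : ℤ} (ha : Admissible f s) (hg : (g : ℤ) = f * s)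
    {x : ℤ × ℤ × ℤ} (hx : x ∈ solutions f s) : sidesOf f s x ∈ sidePairs g := by
  wlog hle : x.2.2 ≤ s * x.1 * x.2.1 - x.2.2 generalizing x
  · rw [← sidesOf_phi₃]
    refine this (phi₃_mapsTo ha.f_pos hx) ?_
    simp only [phi₃]
    linarith
  have hfs : 0 < f * s := mul_pos ha.f_pos ha.s_pos
  have hco := isCoprime_of_mem ha x hx
  obtain ⟨m, n, q⟩ := x
  obtain ⟨hm, hn, hq, h⟩ := hx
  simp only at hm hn hq h hle hco
  simp only [sidesOf]
  rw [sortPair_of_le (mul_le_mul_of_nonneg_left hle hfs.le), mem_sidePairs_iff]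
  refine ⟨by positivity, mul_le_mul_of_nonneg_left hle hfs.le, ?_,
    f * s ^ 2 * (m ^ 2 - n ^ 2), ?_⟩
  · have h1 : IsCoprime q (s * m * n - q) := by
      simpa [sub_eq_add_neg] using IsCoprime.add_mul_left_right hco (-1)
    rw [Int.gcd_mul_left, Int.isCoprime_iff_gcd_eq_one.1 h1, mul_one, ← hg, Int.natAbs_natCast]
  · have h1 : f * q * (s * m * n - q) = m ^ 2 + n ^ 2 := by linear_combination -h
    linear_combination (f * s ^ 2) ^ 2 * (f * q * (s * m * n - q) + (m ^ 2 + n ^ 2)) * h1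

theorem exists_sides {g : ℕ} {f s : ℤ} (ha : Admissible f s) (hg : (g : ℤ) = f * s)
    {p : ℤ × ℤ} (hp : p ∈ sidePairs g) : ∃ x ∈ solutions f s,
      p = (f * s * x.2.2, f * s * (s * x.1 * x.2.1 - x.2.2)) := by
  obtain ⟨a, b⟩ := p
  obtain ⟨h0, hab, hgcd, k, hk⟩ := (mem_sidePairs_iff g _).1 hp
  simp only at h0 hab hgcd hk
  have hfs : 0 < f * s := mul_pos ha.f_pos ha.s_pos
  obtain ⟨q, q', hc, hq, hq'⟩ := Int.exists_gcd_one (m := a) (n := b)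
    (Int.gcd_pos_of_ne_zero_left _ h0.ne')
  rw [hgcd, hg] at hq hq'
  subst hq hq'
  have hq0 : 0 < q := (mul_pos_iff_of_pos_right hfs).1 h0
  have hq0' : 0 < q' := (mul_pos_iff_of_pos_right hfs).1 (h0.trans_le hab)
  obtain ⟨k', rfl⟩ : f * s ∣ k := by
    rw [← Int.pow_dvd_pow_iff two_ne_zero, ← hk]
    exact ⟨(f * s) ^ 2 * (q * q') ^ 2 - 4 * (q + q') ^ 2, by ring⟩
  have hk' : (f * s) ^ 2 * (q * q') ^ 2 - 4 * (q + q') ^ 2 = k' ^ 2 :=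
    mul_left_cancel₀ (pow_ne_zero 2 hfs.ne') (by linear_combination hk)
  obtain ⟨m, n, hmem, he⟩ :=
    exists_solution ha hq0 hq0' (Int.isCoprime_iff_gcd_eq_one.2 hc) hk'
  exact ⟨_, hmem, by simp only [he]; rw [mul_comm q, mul_comm q']⟩

/-! ## The four maps in terms of solutions -/

/-- A fixed point of `φ₁` would give `4 n² + 4 f q² = (f s)² n² q²`, which is impossible because `(f
s)² > 4 + 4 f` for all three parameter pairs. Hence `φ₁` and `φ₂` always change `a + b`; only `φ₃`
can have fixed points. -/
theorem two_mul_ne_phi₁ {f s : ℤ} (ha : Admissible f s) {x : ℤ × ℤ × ℤ}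
    (hx : x ∈ solutions f s) : 2 * x.1 ≠ f * s * x.2.1 * x.2.2 := by
  obtain ⟨m, n, q⟩ := x
  obtain ⟨hm, hn, hq, h⟩ := hx
  simp only at hm hn hq h ⊢
  intro he
  have h1 : m ^ 2 = n ^ 2 + f * q ^ 2 := by linear_combination m * he - h
  have h2 : 4 * (n ^ 2 + f * q ^ 2) = (f * s) ^ 2 * (n ^ 2 * q ^ 2) := by
    rw [← h1]; linear_combination (2 * m + f * s * n * q) * he
  have hN : 1 ≤ n ^ 2 := by nlinarith
  have hQ : 1 ≤ q ^ 2 := by nlinarith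
  have h3 : n ^ 2 * 1 ≤ n ^ 2 * q ^ 2 := mul_le_mul_of_nonneg_left hQ (by linarith)
  have h4 : 1 * q ^ 2 ≤ n ^ 2 * q ^ 2 := mul_le_mul_of_nonneg_right hN (by linarith)
  rcases ha with ⟨rfl, rfl⟩ | ⟨rfl, rfl⟩ | ⟨rfl, rfl⟩ <;> linarith

theorem toReal_injective : Function.Injective toReal := by
  rintro ⟨a, b⟩ ⟨c, d⟩ h
  simp only [toReal, Prod.mk.injEq, Int.cast_inj] at h
  exact Prod.ext h.1 h.2

theorem toReal_sortPair (p : ℤ × ℤ) : toReal (sortPair p) = sortPair (toReal p) := by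
  simp [toReal, sortPair]

theorem disc_comm (a b : ℝ) : disc a b = disc b a := by
  rw [disc, disc]
  congr 1
  ring

theorem sortPair_psi₁ (a b : ℝ) : sortPair (psi₁ (a, b)) = sortPair (varphi₁ (b, a)) := by
  rw [psi₁, varphi₁, sortPair_mk_comm]
  simp only
  rw [disc_comm, mul_comm a (b ^ 2)]

theorem sortPair_psi₂ (a b : ℝ) : sortPair (psi₂ (a, b)) = sortPair (varphi₂ (b, a)) := by
  rw [psi₂, varphi₂, sortPair_mk_comm]
  simp only
  rw [disc_comm, mul_comm a (b ^ 2)]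

/-- The sides attached to a triple, unsorted. -/
def rawSides (f s : ℤ) (x : ℤ × ℤ × ℤ) : ℤ × ℤ :=
  (f * s * x.2.2, f * s * (s * x.1 * x.2.1 - x.2.2))

theorem sortPair_rawSides (f s : ℤ) (x : ℤ × ℤ × ℤ) :
    sortPair (toReal (rawSides f s x)) = toReal (sidesOf f s x) := by
  rw [← toReal_sortPair]; rfl

theorem rawSides_phi₃ (f s : ℤ) (x : ℤ × ℤ × ℤ) :
    rawSides f s (phi₃ s x) = (rawSides f s x).swap := by
  simp [rawSides, phi₃]

theorem disc_rawSides {f s m n q : ℤ} (hf : 0 < f) (hx : (m, n, q) ∈ solutions f s)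
    (hnm : n ≤ m) :
    disc (toReal (rawSides f s (m, n, q))).1 (toReal (rawSides f s (m, n, q))).2 =
      f * s ^ 2 * (m ^ 2 - n ^ 2) := by
  obtain ⟨hm, hn, hq, h⟩ := hx
  simp only at hm hn hq h
  have h1 : (f : ℝ) * q * (s * m * n - q) = m ^ 2 + n ^ 2 := by
    have : f * q * (s * m * n - q) = m ^ 2 + n ^ 2 := by linear_combination -h
    exact_mod_cast this
  have h2 : (0 : ℝ) ≤ m ^ 2 - n ^ 2 := by
    have : 0 ≤ m ^ 2 - n ^ 2 := by nlinarith
    exact_mod_cast this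
  have hf' : (0 : ℝ) < f := by exact_mod_cast hf
  rw [disc, ← Real.sqrt_sq (by positivity : (0 : ℝ) ≤ f * s ^ 2 * (m ^ 2 - n ^ 2))]
  congr 1
  simp only [toReal, rawSides]
  push_cast
  linear_combination (f * s ^ 2 : ℝ) ^ 2 * (f * q * (s * m * n - q) + (m ^ 2 + n ^ 2)) * h1

/-- Keeping the side `f s q` means keeping `q`. The root of the discriminant is `f s² (m² - n²)`
when `n ≤ m`; the opposite order exchanges the two signs, which `sortPair_varphi_iff` absorbs by
treating both maps together. -/
theorem varphi_rawSides {f s : ℤ} (hf : 0 < f) {x : ℤ × ℤ × ℤ} (hx : x ∈ solutions f s)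
    (hle : x.2.1 ≤ x.1) :
    varphi₁ (toReal (rawSides f s x)) = toReal (rawSides f s (phi₂ f s x)) ∧
    varphi₂ (toReal (rawSides f s x)) = toReal (rawSides f s (phi₁ f s x)) := by
  obtain ⟨m, n, q⟩ := x
  have hd := disc_rawSides hf hx hle
  have h1 : (f : ℝ) * q * (s * m * n - q) = m ^ 2 + n ^ 2 := by
    have : f * q * (s * m * n - q) = m ^ 2 + n ^ 2 := by linear_combination -hx.2.2.2
    exact_mod_cast this
  rw [varphi₁, varphi₂, hd]
  constructor
  · ext
    · simp [toReal, rawSides, phi₂]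
    · simp only [toReal, rawSides, phi₂]
      push_cast
      linear_combination (f ^ 2 * s ^ 3 * q / 2 : ℝ) * h1
  · ext
    · simp [toReal, rawSides, phi₁]
    · simp only [toReal, rawSides, phi₁]
      push_cast
      linear_combination (f ^ 2 * s ^ 3 * q / 2 : ℝ) * h1

theorem rawSides_swapTriple (f s : ℤ) (x : ℤ × ℤ × ℤ) :
    rawSides f s (swapTriple x) = rawSides f s x := by
  simp only [rawSides, swapTriple]
  rw [mul_right_comm s]

theorem sortPair_varphi_iff {f s : ℤ} (hf : 0 < f) {x : ℤ × ℤ × ℤ} (hx : x ∈ solutions f s)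
    (r : ℝ × ℝ) :
    (sortPair (varphi₁ (toReal (rawSides f s x))) = r ∨
      sortPair (varphi₂ (toReal (rawSides f s x))) = r) ↔
    (r = toReal (sidesOf f s (phi₁ f s x)) ∨ r = toReal (sidesOf f s (phi₂ f s x))) := by
  wlog hle : x.2.1 ≤ x.1 generalizing x
  · have := this (x := swapTriple x) (swap ⟨x, hx⟩).2 (le_of_not_ge hle)
    rw [rawSides_swapTriple, phi₁_swapTriple, phi₂_swapTriple, sidesOf_swapTriple,
      sidesOf_swapTriple] at this
    rw [this, or_comm]
  obtain ⟨h1, h2⟩ := varphi_rawSides hf hx hle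
  rw [h1, h2, sortPair_rawSides, sortPair_rawSides, or_comm]
  simp only [@eq_comm _ r]

/-- `p` is the pair of sides of `φ₁ y` or `φ₂ y`, where `y` is `x` or `φ₃ x`. -/
def IsSideStep (f s : ℤ) (x : ℤ × ℤ × ℤ) (p : ℤ × ℤ) : Prop :=
  ∃ y, (y = x ∨ y = phi₃ s x) ∧ (p = sidesOf f s (phi₁ f s y) ∨ p = sidesOf f s (phi₂ f s y))

theorem exists_sideMaps_iff {f s : ℤ} (hf : 0 < f) {x : ℤ × ℤ × ℤ} (hx : x ∈ solutions f s)
    (r : ℝ × ℝ) :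
    (∃ F ∈ sideMaps, sortPair (F (toReal (sidesOf f s x))) = r) ↔
      ∃ p, r = toReal p ∧ IsSideStep f s x p := by
  wlog hle : f * s * x.2.2 ≤ f * s * (s * x.1 * x.2.1 - x.2.2) generalizing x
  · have := this (x := phi₃ s x) (phi₃_mapsTo hf hx) (by
      simp only [phi₃]
      rw [sub_sub_cancel]
      exact le_of_not_ge hle)
    rw [sidesOf_phi₃] at this
    simp only [IsSideStep, phi₃_phi₃] at this ⊢
    rw [this]
    simp only [or_comm]
  have h0 : sidesOf f s x = rawSides f s x := sortPair_of_le hle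
  have h1 := sortPair_varphi_iff hf hx r
  have h2 := sortPair_varphi_iff hf (phi₃_mapsTo hf hx) r
  rw [rawSides_phi₃] at h2
  simp only [sideMaps, Set.mem_insert_iff, Set.mem_singleton_iff, exists_eq_or_imp,
    exists_eq_left, h0]
  have h3 : sortPair (psi₁ (toReal (rawSides f s x))) =
    sortPair (varphi₁ (toReal (rawSides f s x).swap)) := sortPair_psi₁ _ _
  have h4 : sortPair (psi₂ (toReal (rawSides f s x))) =
    sortPair (varphi₂ (toReal (rawSides f s x).swap)) := sortPair_psi₂ _ _
  rw [h3, h4, h2, ← or_assoc, h1]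
  constructor
  · rintro ((h | h) | (h | h))
    · exact ⟨_, h, x, Or.inl rfl, Or.inl rfl⟩
    · exact ⟨_, h, x, Or.inl rfl, Or.inr rfl⟩
    · exact ⟨_, h, _, Or.inr rfl, Or.inl rfl⟩
    · exact ⟨_, h, _, Or.inr rfl, Or.inr rfl⟩
  · rintro ⟨p, rfl, y, rfl | rfl, rfl | rfl⟩ <;> tauto

theorem exists_sideMaps_toReal_iff {f s : ℤ} (hf : 0 < f) {x : ℤ × ℤ × ℤ}
    (hx : x ∈ solutions f s) (p : ℤ × ℤ) :
    (∃ F ∈ sideMaps, sortPair (F (toReal (sidesOf f s x))) = toReal p) ↔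
      IsSideStep f s x p := by
  rw [exists_sideMaps_iff hf hx]
  constructor
  · rintro ⟨p', h, h'⟩
    rwa [toReal_injective h]
  · exact fun h => ⟨p, rfl, h⟩

/-- Among the representatives of a pair, one is chosen that `φ₃` does not lower, so that its parent
is either itself or given by `φ₁` or `φ₂`, that is, by an edge between side pairs. -/
theorem exists_reduced {g : ℕ} {f s : ℤ} (ha : Admissible f s) (hg : (g : ℤ) = f * s)
    {p : ℤ × ℤ} (hp : p ∈ sidePairs g) : ∃ x ∈ solutions f s,
      sidesOf f s x = p ∧ 2 * x.2.2 ≤ s * x.1 * x.2.1 := by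
  obtain ⟨x, hx, rfl⟩ := exists_sides ha hg hp
  have h1 := hp.2.1
  simp only at h1
  have h2 := le_of_mul_le_mul_left h1 (mul_pos ha.f_pos ha.s_pos)
  exact ⟨x, hx, sortPair_of_le h1, by linarith⟩

theorem sidesOf_phi₁_ne {f s : ℤ} (ha : Admissible f s) {x : ℤ × ℤ × ℤ}
    (hx : x ∈ solutions f s) : sidesOf f s (phi₁ f s x) ≠ sidesOf f s x := by
  intro h
  have h1 : s * (f * s * x.2.1 * x.2.2 - x.1) * x.2.1 = s * x.1 * x.2.1 := by
    rcases (sidesOf_eq_iff ha.f_pos ha.s_pos _ _).1 h with h1 | h1 <;> exact h1.2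
  have h2 := mul_left_cancel₀ ha.s_pos.ne' (mul_right_cancel₀ hx.2.1.ne' h1)
  exact two_mul_ne_phi₁ ha hx (by linarith)

theorem sidesOf_phi₂_ne {f s : ℤ} (ha : Admissible f s) {x : ℤ × ℤ × ℤ}
    (hx : x ∈ solutions f s) : sidesOf f s (phi₂ f s x) ≠ sidesOf f s x := by
  have := sidesOf_phi₁_ne ha (x := swapTriple x) (swap ⟨x, hx⟩).2
  rwa [phi₁_swapTriple, sidesOf_swapTriple, sidesOf_swapTriple] at this

theorem IsSideStep.ne {f s : ℤ} (ha : Admissible f s) {x : ℤ × ℤ × ℤ}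
    (hx : x ∈ solutions f s) {p : ℤ × ℤ} (h : IsSideStep f s x p) : sidesOf f s x ≠ p := by
  obtain ⟨y, rfl | rfl, rfl | rfl⟩ := h
  · exact (sidesOf_phi₁_ne ha hx).symm
  · exact (sidesOf_phi₂_ne ha hx).symm
  · rw [← sidesOf_phi₃]
    exact (sidesOf_phi₁_ne ha (phi₃_mapsTo ha.f_pos hx)).symm
  · rw [← sidesOf_phi₃]
    exact (sidesOf_phi₂_ne ha (phi₃_mapsTo ha.f_pos hx)).symm

theorem sideStep_symm {f s : ℤ} (ha : Admissible f s) {x x' : ℤ × ℤ × ℤ}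
    (hx : x ∈ solutions f s) (hx' : x' ∈ solutions f s)
    (h : IsSideStep f s x (sidesOf f s x')) : IsSideStep f s x' (sidesOf f s x) := by
  have hf := ha.f_pos
  -- `IsSideStep` depends on the solution only through its sides, since it describes the four maps
  -- on them. It is thus enough to step back from one representative, where `φ₁` and `φ₂` are
  -- involutions.
  have key : ∀ z ∈ solutions f s, sidesOf f s x' = sidesOf f s z →
      IsSideStep f s z (sidesOf f s x) → IsSideStep f s x' (sidesOf f s x) := by
    intro z hz he h
    rw [← exists_sideMaps_toReal_iff hf hx', he]
    exact (exists_sideMaps_toReal_iff hf hz _).2 h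
  obtain ⟨y, hy, h⟩ := h
  have hyS : y ∈ solutions f s := by
    rcases hy with rfl | rfl
    · exact hx
    · exact phi₃_mapsTo hf hx
  have hys : sidesOf f s x = sidesOf f s y := by
    rcases hy with rfl | rfl
    · rfl
    · rw [sidesOf_phi₃]
  rcases h with h | h
  · exact key _ (phi₁_mapsTo hf hyS) h ⟨_, Or.inl rfl, Or.inl (by rw [phi₁_phi₁, hys])⟩
  · exact key _ (phi₂_mapsTo hf hyS) h ⟨_, Or.inl rfl, Or.inr (by rw [phi₂_phi₂, hys])⟩

theorem sideGraph_adj_iff_isSideStep {g : ℕ} {f s : ℤ} (ha : Admissible f s)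
    (hg : (g : ℤ) = f * s) {x : ℤ × ℤ × ℤ} (hx : x ∈ solutions f s) {p p' : sidePairs g}
    (hp : sidesOf f s x = p.1) : (sideGraph g).Adj p p' ↔ IsSideStep f s x p'.1 := by
  obtain ⟨x', hx', hp', -⟩ := exists_reduced ha hg p'.2
  rw [sideGraph, SimpleGraph.fromRel_adj, ← hp, ← hp',
    exists_sideMaps_toReal_iff ha.f_pos hx, exists_sideMaps_toReal_iff ha.f_pos hx']
  constructor
  · rintro ⟨-, h | h⟩
    · exact h
    · exact sideStep_symm ha hx' hx h
  · intro h
    refine ⟨fun he => h.ne ha hx ?_, Or.inl h⟩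
    rw [hp, hp', he]

theorem sideGraph_adj_iff {g : ℕ} {f s : ℤ} (ha : Admissible f s) (hg : (g : ℤ) = f * s)
    (p p' : sidePairs g) : (sideGraph g).Adj p p' ↔
      ∃ F ∈ sideMaps, sortPair (F (toReal p.1)) = toReal p'.1 := by
  obtain ⟨x, hx, hp, -⟩ := exists_reduced ha hg p.2
  rw [sideGraph_adj_iff_isSideStep ha hg hx hp, ← hp, exists_sideMaps_toReal_iff ha.f_pos hx]

theorem IsSideStep.mem {g : ℕ} {f s : ℤ} (ha : Admissible f s) (hg : (g : ℤ) = f * s)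
    {x : ℤ × ℤ × ℤ} (hx : x ∈ solutions f s) {p : ℤ × ℤ} (h : IsSideStep f s x p) :
    p ∈ sidePairs g := by
  have hf := ha.f_pos
  obtain ⟨y, rfl | rfl, rfl | rfl⟩ := h
  · exact sidesOf_mem ha hg (phi₁_mapsTo hf hx)
  · exact sidesOf_mem ha hg (phi₂_mapsTo hf hx)
  · exact sidesOf_mem ha hg (phi₁_mapsTo hf (phi₃_mapsTo hf hx))
  · exact sidesOf_mem ha hg (phi₂_mapsTo hf (phi₃_mapsTo hf hx))

theorem exists_sideMap_image {g : ℕ} {f s : ℤ} (ha : Admissible f s) (hg : (g : ℤ) = f * s)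
    {p : ℤ × ℤ} (hp : p ∈ sidePairs g) {F : ℝ × ℝ → ℝ × ℝ} (hF : F ∈ sideMaps) :
    ∃ p' ∈ sidePairs g, sortPair (F (toReal p)) = toReal p' := by
  obtain ⟨x, hx, rfl, -⟩ := exists_reduced ha hg hp
  obtain ⟨p', h1, h2⟩ := (exists_sideMaps_iff ha.f_pos hx _).1 ⟨F, hF, rfl⟩
  exact ⟨p', h2.mem ha hg hx, h1⟩

/-! ## The solution graph and its quotient by the swap -/

/-- The parent of a solution, as a solution. -/
def parentSol {f s : ℤ} (hf : 0 < f) (x : solutions f s) : solutions f s :=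
  ⟨parent f s x.1, parent_mem hf x.2⟩

theorem height_parentSol_lt {f s : ℤ} (hf : 0 < f) (x : solutions f s)
    (h : parentSol hf x ≠ x) : height (parentSol hf x).1 < height x.1 :=
  height_parent_lt hf x.2 fun he => h (Subtype.ext he)

theorem parentSol_of_adj {f s : ℤ} (hf : 0 < f) (x y : solutions f s)
    (h : (solutionGraph f s).Adj x y) : parentSol hf x = y ∨ parentSol hf y = x := by
  have key : ∀ x y : solutions f s, x ≠ y →
      (y.1 = phi₁ f s x.1 ∨ y.1 = phi₂ f s x.1 ∨ y.1 = phi₃ s x.1) →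
      parent f s x.1 = y.1 ∨ parent f s y.1 = x.1 := by
    intro x y hne h
    have hne' : y.1 ≠ x.1 := fun he => hne (Subtype.ext he.symm)
    rcases h with h | h | h
    · rw [h] at hne' ⊢
      exact parent_phi₁.resolve_left hne'
    · rw [h] at hne' ⊢
      exact (parent_phi₂ hf x.2).resolve_left hne'
    · rw [h] at hne' ⊢
      exact (parent_phi₃ hf x.2).resolve_left hne'
  rw [solutionGraph, SimpleGraph.fromRel_adj] at h
  obtain ⟨hne, h | h⟩ := h
  · exact (key x y hne h).imp Subtype.ext Subtype.ext
  · exact ((key y x hne.symm h).imp Subtype.ext Subtype.ext).symm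

theorem adj_parentSol {f s : ℤ} (hf : 0 < f) (x : solutions f s) (h : parentSol hf x ≠ x) :
    (solutionGraph f s).Adj x (parentSol hf x) := by
  rw [solutionGraph, SimpleGraph.fromRel_adj]
  refine ⟨h.symm, Or.inl ?_⟩
  rcases parent_cases hf x.2 with h1 | h1 | h1 | h1
  · exact Or.inl h1.2
  · exact Or.inr (Or.inl h1.2)
  · exact Or.inr (Or.inr h1.2)
  · exact absurd (Subtype.ext h1.2.2.2) h

theorem one_mem_solutions {f s : ℤ} (ha : Admissible f s) (h5 : f ≠ 5) :
    ((1, 1, 1) : ℤ × ℤ × ℤ) ∈ solutions f s := by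
  rcases ha with ⟨rfl, rfl⟩ | ⟨rfl, rfl⟩ | ⟨rfl, rfl⟩
  · exact ⟨one_pos, one_pos, one_pos, by norm_num⟩
  · exact ⟨one_pos, one_pos, one_pos, by norm_num⟩
  · exact absurd rfl h5

theorem one_two_one_mem_solutions : ((1, 2, 1) : ℤ × ℤ × ℤ) ∈ solutions 5 1 :=
  ⟨one_pos, two_pos, one_pos, by norm_num⟩

theorem solutionGraph_isTree {f s : ℤ} (ha : Admissible f s) (h5 : f ≠ 5) :
    (solutionGraph f s).IsTree := by
  refine isTree_of_parent (parentSol ha.f_pos) (fun x => height x.1)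
    (height_parentSol_lt ha.f_pos) (parentSol_of_adj ha.f_pos) (adj_parentSol ha.f_pos)
    ⟨_, one_mem_solutions ha h5⟩ ?_
  intro x hx
  rcases eq_root_of_parent_eq_self ha x.2 (congrArg Subtype.val hx) with h | h
  · exact absurd h.1 h5
  · exact Subtype.ext h.2

theorem solutionGraph_isAcyclic {f s : ℤ} (hf : 0 < f) : (solutionGraph f s).IsAcyclic :=
  isAcyclic_of_parent (parentSol hf) (fun x => height x.1) (height_parentSol_lt hf)
    (parentSol_of_adj hf)

theorem parentSol_swap {f s : ℤ} (hf : 0 < f) (x : solutions f s) :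
    parentSol hf (swap x) = swap (parentSol hf x) :=
  Subtype.ext (parent_swapTriple hf x.2)

theorem height_swap {f s : ℤ} (x : solutions f s) : height (swap x).1 = height x.1 := by
  simp only [height, swap]
  rw [add_comm x.1.2.1]

/-- The only roots are `(1, 2, 1)` and its swap, and the swap commutes with `parent`, so `y` and
`swap y` lie above different roots. The equivalence expresses that there are exactly two components
and that the swap exchanges them. -/
theorem reachable_iff_not_reachable_swap (x y : solutions 5 1) :
    (solutionGraph 5 1).Reachable x y ↔ ¬ (solutionGraph 5 1).Reachable x (swap y) := by
  have hf : (0 : ℤ) < 5 := by norm_num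
  have ha : Admissible 5 1 := Or.inr (Or.inr ⟨rfl, rfl⟩)
  set p : solutions 5 1 → solutions 5 1 := parentSol hf with hp
  have key := reachable_iff_of_parent p (fun x => height x.1) (height_parentSol_lt hf)
    (parentSol_of_adj hf) (adj_parentSol hf)
  have hroot : ∀ x : solutions 5 1, p^[height x.1] x = ⟨_, one_two_one_mem_solutions⟩ ∨
      p^[height x.1] x = swap ⟨_, one_two_one_mem_solutions⟩ := by
    intro x
    have hfix := iterate_parent_fixed p (fun x => height x.1) (height_parentSol_lt hf) _ x le_rfl
    rcases eq_root_of_parent_eq_self ha (p^[height x.1] x).2 (congrArg Subtype.val hfix) with h | h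
    · exact h.2.imp Subtype.ext Subtype.ext
    · exact absurd rfl h.1
  have hswap : p^[height (swap y).1] (swap y) = swap (p^[height y.1] y) := by
    rw [height_swap]
    exact ((Function.Commute.iterate_left (f := p) (g := swap) (parentSol_swap hf) _) y)
  have hne : (⟨_, one_two_one_mem_solutions⟩ : solutions 5 1) ≠
      swap ⟨_, one_two_one_mem_solutions⟩ := by
    intro h
    have := congrArg (fun x => x.1.1) h
    norm_num [swap] at this
  rw [key, key, hswap]
  rcases hroot x with h1 | h1 <;> rcases hroot y with h2 | h2 <;> rw [h1, h2]
  · simp [hne]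
  · simp [hne, swap_swap]
  · simp [hne.symm]
  · simp [hne.symm, swap_swap]

/-- The parent function on the quotient by the swap. -/
def parentQuot {f s : ℤ} (hf : 0 < f) : Quot (swapRel f s) → Quot (swapRel f s) :=
  Quot.map (parentSol hf) fun x y h => by
    rw [swapRel] at h ⊢
    rw [h, parentSol_swap]

/-- The height on the quotient by the swap. -/
def heightQuot {f s : ℤ} : Quot (swapRel f s) → ℕ :=
  Quot.lift (fun x => height x.1) fun x y h => by
    rw [swapRel] at h
    rw [h, height_swap]

theorem swapQuotient_isTree {f s : ℤ} (ha : Admissible f s) : (swapQuotient f s).IsTree := by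
  have hf := ha.f_pos
  obtain ⟨r, hr⟩ : ∃ r : Quot (swapRel f s), ∀ x : solutions f s, parentSol hf x = x →
      Quot.mk _ x = r := by
    by_cases h5 : f = 5
    · have hs : s = 1 := by
        rcases ha with h | h | h <;> omega
      subst h5 hs
      refine ⟨Quot.mk _ ⟨_, one_two_one_mem_solutions⟩, fun x hx => ?_⟩
      rcases eq_root_of_parent_eq_self ha x.2 (congrArg Subtype.val hx) with ⟨-, h | h⟩ | h
      · exact congrArg _ (Subtype.ext h)
      · refine (Quot.sound ?_).symm
        exact Subtype.ext h
      · exact absurd rfl h.1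
    · refine ⟨Quot.mk _ ⟨_, one_mem_solutions ha h5⟩, fun x hx => ?_⟩
      rcases eq_root_of_parent_eq_self ha x.2 (congrArg Subtype.val hx) with h | h
      · exact absurd h.1 h5
      · exact congrArg _ (Subtype.ext h.2)
  refine isTree_of_parent (parentQuot hf) heightQuot ?_ ?_ ?_ r ?_
  · rintro ⟨x⟩ h
    exact height_parentSol_lt hf x fun he => h (congrArg (Quot.mk _) he)
  · rintro A B ⟨-, x, y, rfl, rfl, hxy⟩
    exact (parentSol_of_adj hf x y hxy).imp (congrArg (Quot.mk _)) (congrArg (Quot.mk _))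
  · rintro ⟨x⟩ h
    exact ⟨h.symm, x, _, rfl, rfl, adj_parentSol hf x fun he => h (congrArg (Quot.mk _) he)⟩
  · rintro ⟨x⟩ h
    refine hr x ?_
    -- A class can be fixed only if the parent of `x` is `x` or its swap. The swap preserves height,
    -- so the parent has not gone down and equals `x`.
    by_contra hne
    exact (height_parentSol_lt hf x hne).ne (congrArg heightQuot h)

/-! ## The graph on side pairs -/

theorem reduced_of_sidesOf_parent_ne {f s : ℤ} (hf : 0 < f) {x : ℤ × ℤ × ℤ}
    (hx : x ∈ solutions f s) (h : sidesOf f s (parent f s x) ≠ sidesOf f s x) :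
    2 * x.2.2 ≤ s * x.1 * x.2.1 := by
  by_contra! hlt
  rw [parent_eq_phi₃ hf hx hlt, sidesOf_phi₃] at h
  exact h rfl

theorem phi₃_eq_self {s : ℤ} {x : ℤ × ℤ × ℤ} (h1 : 2 * x.2.2 ≤ s * x.1 * x.2.1)
    (h2 : 2 * (phi₃ s x).2.2 ≤ s * (phi₃ s x).1 * (phi₃ s x).2.1) : phi₃ s x = x := by
  simp only [phi₃] at h2
  ext
  · rfl
  · rfl
  · simp only [phi₃]; linarith

/-- This makes the parent of a side pair independent of the reduced representative: if `x` and its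
`φ₃`-image are both reduced, they coincide, and so only the swap remains. -/
theorem sidesOf_parent_congr {f s : ℤ} (ha : Admissible f s) {x y : ℤ × ℤ × ℤ}
    (hx : x ∈ solutions f s) (hy : y ∈ solutions f s) (h : sidesOf f s x = sidesOf f s y)
    (hxr : 2 * x.2.2 ≤ s * x.1 * x.2.1) (hyr : 2 * y.2.2 ≤ s * y.1 * y.2.1) :
    sidesOf f s (parent f s x) = sidesOf f s (parent f s y) := by
  have hf := ha.f_pos
  rcases eq_of_sidesOf_eq hf ha.s_pos hx hy h with rfl | rfl | rfl | rfl
  · rfl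
  · rw [parent_swapTriple hf hx, sidesOf_swapTriple]
  · rw [phi₃_eq_self hxr hyr]
  · have : phi₃ s x = x := by
      refine phi₃_eq_self hxr ?_
      simp only [swapTriple] at hyr
      rwa [mul_right_comm]
    rw [this, parent_swapTriple hf hx, sidesOf_swapTriple]

theorem sum_sortPair (p : ℤ × ℤ) : (sortPair p).1 + (sortPair p).2 = p.1 + p.2 :=
  min_add_max _ _

theorem sum_sidesOf (f s : ℤ) (x : ℤ × ℤ × ℤ) :
    (sidesOf f s x).1 + (sidesOf f s x).2 = f * s ^ 2 * (x.1 * x.2.1) := by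
  rw [sidesOf, sum_sortPair]
  ring

theorem parent_phi_of_isSideStep {f s : ℤ} (ha : Admissible f s) {x : ℤ × ℤ × ℤ}
    (hx : x ∈ solutions f s) {p : ℤ × ℤ} (h : IsSideStep f s x p) :
    ∃ y ∈ solutions f s, ∃ z ∈ solutions f s, sidesOf f s y = sidesOf f s x ∧
      sidesOf f s z = p ∧ (parent f s y = z ∨ parent f s z = y) := by
  have hf := ha.f_pos
  obtain ⟨y, hy, h⟩ := h
  have hyS : y ∈ solutions f s := by
    rcases hy with rfl | rfl
    · exact hx
    · exact phi₃_mapsTo hf hx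
  have hys : sidesOf f s y = sidesOf f s x := by
    rcases hy with rfl | rfl
    · rfl
    · rw [sidesOf_phi₃]
  rcases h with h | h
  · exact ⟨y, hyS, _, phi₁_mapsTo hf hyS, hys, h.symm, parent_phi₁.resolve_left fun he =>
      sidesOf_phi₁_ne ha hyS (congrArg _ he)⟩
  · exact ⟨y, hyS, _, phi₂_mapsTo hf hyS, hys, h.symm, (parent_phi₂ hf hyS).resolve_left fun he =>
      sidesOf_phi₂_ne ha hyS (congrArg _ he)⟩

/-- `root` is the pair of sides attached to the roots for the parameters `(f, s)`. -/
def IsRootPair (f s : ℤ) (root : ℤ × ℤ) : Prop :=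
  (f = 1 ∧ s = 3 ∧ root = (3, 6)) ∨ (f = 2 ∧ s = 2 ∧ root = (4, 4)) ∨
    (f = 5 ∧ s = 1 ∧ root = (5, 5))

theorem IsRootPair.admissible {f s : ℤ} {root : ℤ × ℤ} (h : IsRootPair f s root) :
    Admissible f s := by
  rcases h with h | h | h
  · exact Or.inl ⟨h.1, h.2.1⟩
  · exact Or.inr (Or.inl ⟨h.1, h.2.1⟩)
  · exact Or.inr (Or.inr ⟨h.1, h.2.1⟩)

theorem sidesOf_eq_root {f s : ℤ} {root : ℤ × ℤ} (hr : IsRootPair f s root) {x : ℤ × ℤ × ℤ}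
    (hx : (f = 5 ∧ (x = (1, 2, 1) ∨ x = (2, 1, 1))) ∨ (f ≠ 5 ∧ x = (1, 1, 1))) :
    sidesOf f s x = root := by
  rcases hr with ⟨rfl, rfl, rfl⟩ | ⟨rfl, rfl, rfl⟩ | ⟨rfl, rfl, rfl⟩
  · obtain ⟨h, -⟩ | ⟨-, rfl⟩ := hx
    · norm_num at h
    · norm_num [sidesOf, sortPair]
  · obtain ⟨h, -⟩ | ⟨-, rfl⟩ := hx
    · norm_num at h
    · norm_num [sidesOf, sortPair]
  · obtain ⟨-, rfl | rfl⟩ | ⟨h, -⟩ := hx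
    · norm_num [sidesOf, sortPair]
    · norm_num [sidesOf, sortPair]
    · exact absurd rfl h

theorem root_mem {g : ℕ} {f s : ℤ} {root : ℤ × ℤ} (hr : IsRootPair f s root)
    (hg : (g : ℤ) = f * s) : root ∈ sidePairs g := by
  have ha := hr.admissible
  by_cases h5 : f = 5
  · have hs : s = 1 := by
      rcases ha with h | h | h <;> omega
    subst h5 hs
    rw [← sidesOf_eq_root hr (Or.inl ⟨rfl, Or.inl rfl⟩)]
    exact sidesOf_mem ha hg one_two_one_mem_solutions
  · rw [← sidesOf_eq_root hr (Or.inr ⟨h5, rfl⟩)]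
    exact sidesOf_mem ha hg (one_mem_solutions ha h5)

theorem sideGraph_isTree {g : ℕ} {f s : ℤ} {root : ℤ × ℤ} (hr : IsRootPair f s root)
    (hg : (g : ℤ) = f * s) : (sideGraph g).IsTree := by
  have ha := hr.admissible
  have hf := ha.f_pos
  have hs := ha.s_pos
  choose σ hσ hσp hσr using fun p : sidePairs g => exists_reduced ha hg p.2
  have hpos : 0 < f * s ^ 2 := by positivity
  refine isTree_of_parent
    (fun p => (⟨sidesOf f s (parent f s (σ p)), sidesOf_mem ha hg (parent_mem hf (hσ p))⟩ :
      sidePairs g))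
    (fun p => (p.1.1 + p.1.2).toNat) ?_ ?_ ?_ ⟨root, root_mem hr hg⟩ ?_
  · intro p hp
    have h0 : 0 < p.1.1 + p.1.2 := add_pos p.2.1 (p.2.1.trans_le p.2.2.1)
    refine (Int.toNat_lt_toNat h0).2 ?_
    rw [← hσp p] at *
    rw [sum_sidesOf, sum_sidesOf]
    obtain ⟨hm, hn, -⟩ := hσ p
    rcases parent_cases hf (hσ p) with h | h | h | h
    · rw [h.2]
      simp only [phi₁]
      exact mul_lt_mul_of_pos_left (mul_lt_mul_of_pos_right (by linarith [h.1]) hn) hpos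
    · rw [h.2]
      simp only [phi₂]
      exact mul_lt_mul_of_pos_left (mul_lt_mul_of_pos_left (by linarith [h.1]) hm) hpos
    · exact absurd h.1 (hσr p).not_gt
    · refine absurd (Subtype.ext ?_) hp
      simp only
      rw [h.2.2.2, hσp]
  · intro p p' hpp'
    have hne := hpp'.ne
    have hst := (sideGraph_adj_iff_isSideStep ha hg (hσ p) (hσp p)).1 hpp'
    -- The edge lifts to solutions `y`, `z`, one the parent of the other. The child is reduced,
    -- since otherwise its parent would be its `φ₃`-image, with the same sides; so it may replace
    -- the chosen representative.
    obtain ⟨y, hy, z, hz, hys, hzs, h⟩ := parent_phi_of_isSideStep ha (hσ p) hst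
    have hyz : sidesOf f s y ≠ sidesOf f s z := by
      rw [hys, hzs, hσp]
      exact fun he => hne (Subtype.ext he)
    rcases h with rfl | rfl
    · left
      refine Subtype.ext ?_
      rw [← hzs]
      exact sidesOf_parent_congr ha (hσ p) hy hys.symm (hσr p)
        (reduced_of_sidesOf_parent_ne hf hy hyz.symm)
    · right
      refine Subtype.ext ?_
      rw [← hσp p, ← hys]
      exact sidesOf_parent_congr ha (hσ p') hz (by rw [hσp, hzs]) (hσr p')
        (reduced_of_sidesOf_parent_ne hf hz hyz)
  · intro p hp
    rw [sideGraph_adj_iff_isSideStep ha hg (hσ p) (hσp p)]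
    rcases parent_cases hf (hσ p) with h | h | h | h
    · exact ⟨_, Or.inl rfl, Or.inl (congrArg (sidesOf f s) h.2)⟩
    · exact ⟨_, Or.inl rfl, Or.inr (congrArg (sidesOf f s) h.2)⟩
    · exact absurd h.1 (hσr p).not_gt
    · refine absurd (Subtype.ext ?_) hp
      simp only
      rw [h.2.2.2, hσp]
  · intro p hp
    have hp' : sidesOf f s (parent f s (σ p)) = sidesOf f s (σ p) := by
      rw [hσp]
      exact congrArg Subtype.val hp
    refine Subtype.ext ?_
    rw [← hσp p]
    rcases parent_cases hf (hσ p) with h | h | h | h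
    · rw [h.2] at hp'
      exact absurd hp' (sidesOf_phi₁_ne ha (hσ p))
    · rw [h.2] at hp'
      exact absurd hp' (sidesOf_phi₂_ne ha (hσ p))
    · exact absurd h.1 (hσr p).not_gt
    · exact sidesOf_eq_root hr (eq_root_of_parent_eq_self ha (hσ p) h.2.2.2)

/-! ## The contracted graph -/

/-- The pair of sides of a class in the contracted graph. -/
def contractedSides {g : ℕ} {f s : ℤ} (ha : Admissible f s) (hg : (g : ℤ) = f * s) :
    Quot (phi₃Rel f s) → sidePairs g :=
  Quot.lift
    (Quot.lift (fun x : solutions f s => (⟨sidesOf f s x.1, sidesOf_mem ha hg x.2⟩ : sidePairs g))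
      fun x y h => by
        rw [swapRel] at h
        subst h
        exact Subtype.ext (sidesOf_swapTriple f s x.1).symm)
    (by
      rintro _ _ ⟨x, y, rfl, rfl, h⟩
      refine Subtype.ext ?_
      simp only
      rw [h, sidesOf_phi₃])

/-- The class of a solution in the contracted graph. -/
def contractedMk {f s : ℤ} (x : solutions f s) : Quot (phi₃Rel f s) := Quot.mk _ (Quot.mk _ x)

theorem contractedMk_eq {f s : ℤ} (ha : Admissible f s) {x y : solutions f s}
    (h : sidesOf f s x.1 = sidesOf f s y.1) : contractedMk x = contractedMk y := by
  have hswap : ∀ z : solutions f s,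
      (Quot.mk (swapRel f s) (swap z)) = Quot.mk (swapRel f s) z := fun z =>
    (Quot.sound (r := swapRel f s) (a := z) (b := swap z) rfl).symm
  rcases eq_of_sidesOf_eq ha.f_pos ha.s_pos x.2 y.2 h with h | h | h | h
  · rw [Subtype.ext h]
  · have : y = swap x := Subtype.ext h
    rw [this, contractedMk, contractedMk, hswap]
  · exact Quot.sound ⟨x, y, rfl, rfl, h⟩
  · refine Quot.sound ⟨x, swap y, rfl, hswap y, ?_⟩
    rw [show (swap y).1 = swapTriple y.1 from rfl, h]
    rfl

theorem contractedSides_bijective {g : ℕ} {f s : ℤ} (ha : Admissible f s)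
    (hg : (g : ℤ) = f * s) : Function.Bijective (contractedSides ha hg) := by
  constructor
  · rintro ⟨⟨x⟩⟩ ⟨⟨y⟩⟩ h
    exact contractedMk_eq ha (congrArg Subtype.val h)
  · intro p
    obtain ⟨x, hx, hp, -⟩ := exists_reduced ha hg p.2
    exact ⟨contractedMk ⟨x, hx⟩, Subtype.ext hp⟩

theorem sideGraph_adj_contractedSides_iff {g : ℕ} {f s : ℤ} (ha : Admissible f s)
    (hg : (g : ℤ) = f * s) (A B : Quot (phi₃Rel f s)) :
    (sideGraph g).Adj (contractedSides ha hg A) (contractedSides ha hg B) ↔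
      (contractedGraph f s).Adj A B := by
  have hf := ha.f_pos
  constructor
  · obtain ⟨⟨x⟩⟩ := A
    obtain ⟨⟨w⟩⟩ := B
    intro h
    have hAB : contractedMk x ≠ contractedMk w := fun he =>
      h.ne (congrArg (contractedSides ha hg) he)
    obtain ⟨y, hy, h⟩ := (sideGraph_adj_iff_isSideStep ha hg x.2 rfl).1 h
    change sidesOf f s w.1 = _ ∨ sidesOf f s w.1 = _ at h
    have hyS : y ∈ solutions f s := by
      rcases hy with rfl | rfl
      · exact x.2
      · exact phi₃_mapsTo hf x.2
    have hys : contractedMk ⟨y, hyS⟩ = contractedMk x := by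
      refine contractedMk_eq ha ?_
      rcases hy with rfl | rfl
      · rfl
      · exact sidesOf_phi₃ _ _ _
    obtain ⟨z, hwz, hz⟩ : ∃ z : solutions f s, contractedMk w = contractedMk z ∧
        (z.1 = phi₁ f s y ∨ z.1 = phi₂ f s y) := by
      rcases h with h | h
      · exact ⟨⟨_, phi₁_mapsTo hf hyS⟩, contractedMk_eq ha h, Or.inl rfl⟩
      · exact ⟨⟨_, phi₂_mapsTo hf hyS⟩, contractedMk_eq ha h, Or.inr rfl⟩
    have hyz : contractedMk ⟨y, hyS⟩ ≠ contractedMk z := by rwa [hys, ← hwz]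
    refine ⟨hAB, Quot.mk _ ⟨y, hyS⟩, Quot.mk _ z, hys, hwz.symm, ?_, _, _, rfl, rfl, ?_⟩
    · exact fun he => hyz (congrArg (Quot.mk _) he)
    · rw [solutionGraph, SimpleGraph.fromRel_adj]
      refine ⟨fun he => hyz (congrArg contractedMk he), Or.inl ?_⟩
      rcases hz with hz | hz
      · exact Or.inl hz
      · exact Or.inr (Or.inl hz)
  · rintro ⟨hAB, _, _, rfl, rfl, -, x, y, rfl, rfl, hxy⟩
    rw [solutionGraph, SimpleGraph.fromRel_adj] at hxy
    have key : ∀ x y : solutions f s, contractedMk x ≠ contractedMk y →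
        (y.1 = phi₁ f s x.1 ∨ y.1 = phi₂ f s x.1 ∨ y.1 = phi₃ s x.1) →
        (sideGraph g).Adj (contractedSides ha hg (contractedMk x))
          (contractedSides ha hg (contractedMk y)) := by
      intro x y hne h
      rw [sideGraph_adj_iff_isSideStep ha hg x.2 rfl]
      rcases h with h | h | h
      · exact ⟨_, Or.inl rfl, Or.inl (congrArg (sidesOf f s) h)⟩
      · exact ⟨_, Or.inl rfl, Or.inr (congrArg (sidesOf f s) h)⟩
      · exact absurd (Quot.sound ⟨x, y, rfl, rfl, h⟩) hne
    obtain ⟨-, h | h⟩ := hxy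
    · exact key x y hAB h
    · exact (key y x hAB.symm h).symm

/-- Contracting the `φ₃`-edges of the quotient by the swap yields the graph on side pairs. -/
def contractedIso {g : ℕ} {f s : ℤ} (ha : Admissible f s) (hg : (g : ℤ) = f * s) :
    contractedGraph f s ≃g sideGraph g where
  toEquiv := Equiv.ofBijective _ (contractedSides_bijective ha hg)
  map_rel_iff' := sideGraph_adj_contractedSides_iff ha hg _ _

/-! ## Infinitude, the root and the degrees -/

/-- Replacing the smaller of `m`, `n` always raises it: `m ≤ n` gives `2 m² < m² + n² + f q² = f s m
n q`. -/
theorem exists_larger_sides {f s : ℤ} (hf : 0 < f) (hs : 0 < s) {x : ℤ × ℤ × ℤ}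
    (hx : x ∈ solutions f s) : ∃ y ∈ solutions f s,
      (sidesOf f s x).1 + (sidesOf f s x).2 < (sidesOf f s y).1 + (sidesOf f s y).2 := by
  wlog hle : x.1 ≤ x.2.1 generalizing x
  · have := this (x := swapTriple x) (swap ⟨x, hx⟩).2 (le_of_not_ge hle)
    rwa [sidesOf_swapTriple] at this
  refine ⟨_, phi₁_mapsTo hf hx, ?_⟩
  rw [sum_sidesOf, sum_sidesOf]
  obtain ⟨m, n, q⟩ := x
  obtain ⟨hm, hn, hq, h⟩ := hx
  simp only at hm hn hq h hle
  simp only [phi₁]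
  refine mul_lt_mul_of_pos_left (mul_lt_mul_of_pos_right ?_ hn) (by positivity)
  have h1 : 0 < f * q ^ 2 := by positivity
  have h2 : m * (2 * m) < m * (f * s * n * q) := by nlinarith
  linarith [lt_of_mul_lt_mul_left h2 hm.le]

theorem sidePairs_infinite {g : ℕ} {f s : ℤ} {root : ℤ × ℤ} (hr : IsRootPair f s root)
    (hg : (g : ℤ) = f * s) : Infinite (sidePairs g) := by
  have ha := hr.admissible
  refine not_finite_iff_infinite.1 fun hfin => ?_
  have : Nonempty (sidePairs g) := ⟨⟨root, root_mem hr hg⟩⟩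
  obtain ⟨p, hp⟩ := Finite.exists_max fun p : sidePairs g => p.1.1 + p.1.2
  obtain ⟨x, hx, hxp, -⟩ := exists_reduced ha hg p.2
  obtain ⟨y, hy, h⟩ := exists_larger_sides ha.f_pos ha.s_pos hx
  rw [hxp] at h
  exact (hp ⟨_, sidesOf_mem ha hg hy⟩).not_gt h

theorem sidesOf_eq_root_of_one_one {f s : ℤ} {root : ℤ × ℤ} (hr : IsRootPair f s root)
    {x : ℤ × ℤ × ℤ} (hx : x ∈ solutions f s) (h1 : x.1 = 1) (h2 : x.2.1 = 1) :
    sidesOf f s x = root := by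
  obtain ⟨m, n, q⟩ := x
  obtain ⟨-, -, hq, h⟩ := hx
  simp only at hq h h1 h2
  subst h1 h2
  rcases hr with ⟨rfl, rfl, rfl⟩ | ⟨rfl, rfl, rfl⟩ | ⟨rfl, rfl, rfl⟩
  · have : (q - 1) * (q - 2) = 0 := by linarith
    rcases mul_eq_zero.1 this with h3 | h3
    · obtain rfl : q = 1 := by linarith
      norm_num [sidesOf, sortPair]
    · obtain rfl : q = 2 := by linarith
      norm_num [sidesOf, sortPair]
  · have : (q - 1) ^ 2 = 0 := by linarith
    have h3 := pow_eq_zero_iff two_ne_zero |>.1 this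
    obtain rfl : q = 1 := by linarith
    norm_num [sidesOf, sortPair]
  · omega

theorem sidesOf_eq_root_of_mul_eq_two {root : ℤ × ℤ} (hr : IsRootPair 5 1 root)
    {x : ℤ × ℤ × ℤ} (hx : x ∈ solutions 5 1) (h2 : x.1 * x.2.1 = 2) :
    sidesOf 5 1 x = root := by
  obtain ⟨m, n, q⟩ := x
  obtain ⟨hm, hn, hq, h⟩ := hx
  simp only at hm hn hq h h2
  have hm2 : m ≤ 2 := Int.le_of_dvd two_pos ⟨n, h2.symm⟩
  have hq1 : m ^ 2 + n ^ 2 = 5 → q = 1 := by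
    intro h5
    have : (q - 1) ^ 2 = 0 := by nlinarith
    have h3 := pow_eq_zero_iff two_ne_zero |>.1 this
    linarith
  have : (m = 1 ∧ n = 2) ∨ (m = 2 ∧ n = 1) := by
    interval_cases m <;> omega
  rcases this with ⟨rfl, rfl⟩ | ⟨rfl, rfl⟩
  · obtain rfl := hq1 (by norm_num)
    exact sidesOf_eq_root hr (Or.inl ⟨rfl, Or.inl rfl⟩)
  · obtain rfl := hq1 (by norm_num)
    exact sidesOf_eq_root hr (Or.inl ⟨rfl, Or.inr rfl⟩)

theorem eq_one_of_mul_eq_one {m n : ℤ} (hm : 0 < m) (h : m * n = 1) : m = 1 ∧ n = 1 := by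
  have h1 : m = 1 := le_antisymm (Int.le_of_dvd one_pos ⟨n, h.symm⟩) hm
  subst h1
  exact ⟨rfl, by linarith⟩

theorem root_sum_lt {g : ℕ} {f s : ℤ} {root : ℤ × ℤ} (hr : IsRootPair f s root)
    (hg : (g : ℤ) = f * s) {p : ℤ × ℤ} (hp : p ∈ sidePairs g) (hne : p ≠ root) :
    root.1 + root.2 < p.1 + p.2 := by
  obtain ⟨x, hx, rfl, -⟩ := exists_reduced hr.admissible hg hp
  rw [sum_sidesOf]
  have h0 : 0 < x.1 * x.2.1 := mul_pos hx.1 hx.2.1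
  have h1 : x.1 * x.2.1 ≠ 1 := fun h => by
    obtain ⟨hm, hn⟩ := eq_one_of_mul_eq_one hx.1 h
    exact hne (sidesOf_eq_root_of_one_one hr hx hm hn)
  rcases hr with ⟨rfl, rfl, rfl⟩ | ⟨rfl, rfl, rfl⟩ | ⟨rfl, rfl, rfl⟩
  · simp only; omega
  · simp only; omega
  · have h2 : x.1 * x.2.1 ≠ 2 := fun h =>
      hne (sidesOf_eq_root_of_mul_eq_two (Or.inr (Or.inr ⟨rfl, rfl, rfl⟩)) hx h)
    simp only; omega

/-- If `m = n`, then `m²` divides `f q²` and is coprime to `q`, so it divides the squarefree `f`;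
hence `m = 1`. -/
theorem fst_ne_snd_of_ne_root {f s : ℤ} {root : ℤ × ℤ} (hr : IsRootPair f s root)
    {x : ℤ × ℤ × ℤ} (hx : x ∈ solutions f s) (hne : sidesOf f s x ≠ root) : x.1 ≠ x.2.1 := by
  intro hmn
  have hco := isCoprime_of_mem hr.admissible x hx
  refine hne (sidesOf_eq_root_of_one_one hr hx ?_ ?_)
  all_goals
    obtain ⟨m, n, q⟩ := x
    obtain ⟨hm, hn, hq, h⟩ := hx
    simp only at hm hn hq h hmn hco ⊢
    subst hmn
    have hd : m ^ 2 ∣ f * q ^ 2 := ⟨f * s * q - 2, by linear_combination h⟩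
    have hc : IsCoprime (m ^ 2) (q ^ 2) :=
      (IsCoprime.of_mul_right_right hco).symm.pow
    have hdf := hc.dvd_of_dvd_mul_right hd
    have hle := Int.le_of_dvd hr.admissible.f_pos hdf
    have hm2 : m ≤ 2 := by
      rcases hr with ⟨rfl, -⟩ | ⟨rfl, -⟩ | ⟨rfl, -⟩ <;> nlinarith
    by_contra hm1
    obtain rfl : m = 2 := by omega
    rcases hr with ⟨rfl, -⟩ | ⟨rfl, -⟩ | ⟨rfl, -⟩ <;> norm_num at hdf

/-- If `2 q = s m n`, then coprimality of `q` and `s m n` forces `q = 1` and `s m n = 2`, which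
leaves only the root. -/
theorem two_mul_ne_phi₃_of_ne_root {f s : ℤ} {root : ℤ × ℤ} (hr : IsRootPair f s root)
    {x : ℤ × ℤ × ℤ} (hx : x ∈ solutions f s) (hne : sidesOf f s x ≠ root) :
    2 * x.2.2 ≠ s * x.1 * x.2.1 := by
  intro hq2
  have hco := isCoprime_of_mem hr.admissible x hx
  have hq1 : x.2.2 = 1 := by
    have h1 := hco.isUnit_of_dvd' dvd_rfl ⟨2, by rw [← hq2]; ring⟩
    rcases Int.isUnit_iff.1 h1 with h1 | h1
    · exact h1
    · have := hx.2.2.1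
      omega
  rw [hq1, mul_assoc] at hq2
  rcases hr with ⟨rfl, rfl, hroot⟩ | ⟨rfl, rfl, hroot⟩ | ⟨rfl, rfl, hroot⟩
  · omega
  · obtain ⟨h1, h2⟩ := eq_one_of_mul_eq_one hx.1 (by linarith : x.1 * x.2.1 = 1)
    exact hne (sidesOf_eq_root_of_one_one (Or.inr (Or.inl ⟨rfl, rfl, hroot⟩)) hx h1 h2)
  · exact hne (sidesOf_eq_root_of_mul_eq_two (Or.inr (Or.inr ⟨rfl, rfl, hroot⟩)) hx (by linarith))

theorem encard_neighborSet {g : ℕ} {f s : ℤ} (ha : Admissible f s)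
    (hg : (g : ℤ) = f * s) {x : ℤ × ℤ × ℤ} (hx : x ∈ solutions f s) {p : sidePairs g}
    (hp : sidesOf f s x = p.1) : ((sideGraph g).neighborSet p).encard =
      ({sidesOf f s (phi₁ f s x), sidesOf f s (phi₂ f s x), sidesOf f s (phi₁ f s (phi₃ s x)),
        sidesOf f s (phi₂ f s (phi₃ s x))} : Set (ℤ × ℤ)).encard := by
  rw [← Subtype.val_injective.encard_image]
  congr 1
  ext p'
  have h : p' ∈ Subtype.val '' (sideGraph g).neighborSet p ↔ IsSideStep f s x p' := by
    constructor
    · rintro ⟨p', h, rfl⟩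
      exact (sideGraph_adj_iff_isSideStep ha hg hx hp).1 h
    · intro h
      exact ⟨⟨p', h.mem ha hg hx⟩, (sideGraph_adj_iff_isSideStep ha hg hx hp).2 h, rfl⟩
  rw [h]
  simp only [Set.mem_insert_iff, Set.mem_singleton_iff, IsSideStep]
  constructor
  · rintro ⟨y, rfl | rfl, h⟩ <;> tauto
  · rintro (h | h | h | h)
    · exact ⟨_, Or.inl rfl, Or.inl h⟩
    · exact ⟨_, Or.inl rfl, Or.inr h⟩
    · exact ⟨_, Or.inr rfl, Or.inl h⟩
    · exact ⟨_, Or.inr rfl, Or.inr h⟩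

theorem sidesOf_phi₁_ne_sidesOf_phi₂ {f s : ℤ} (hf : 0 < f) (hs : 0 < s) {x : ℤ × ℤ × ℤ}
    (hx : x ∈ solutions f s) (hne : x.1 ≠ x.2.1) :
    sidesOf f s (phi₁ f s x) ≠ sidesOf f s (phi₂ f s x) := by
  obtain ⟨m, n, q⟩ := x
  obtain ⟨hm, hn, hq, -⟩ := hx
  simp only at hm hn hq hne
  intro h
  have h1 : s * (f * s * n * q - m) * n = s * m * (f * s * m * q - n) := by
    rcases (sidesOf_eq_iff hf hs _ _).1 h with h1 | h1 <;> exact h1.2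
  have h2 : f * s ^ 2 * q * n ^ 2 = f * s ^ 2 * q * m ^ 2 := by linear_combination h1
  have h3 : n ^ 2 = m ^ 2 := mul_left_cancel₀ (by positivity) h2
  exact hne ((pow_left_inj₀ hn.le hm.le two_ne_zero).1 h3).symm

/-- One pair contains the side of `q`, the other that of `q'`. If they agree and `q ≠ q'`, both
consist of these two sides, so `z` has the sides of `x`, although `φ₁` and `φ₂` never preserve
sides. -/
theorem sidesOf_phi_ne_sidesOf_phi_phi₃ {f s : ℤ} (ha : Admissible f s) {x y z : ℤ × ℤ × ℤ}
    (hx : x ∈ solutions f s) (hq : 2 * x.2.2 ≠ s * x.1 * x.2.1)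
    (hy : y = phi₁ f s x ∨ y = phi₂ f s x)
    (hz : z = phi₁ f s (phi₃ s x) ∨ z = phi₂ f s (phi₃ s x)) :
    sidesOf f s y ≠ sidesOf f s z := by
  have hf := ha.f_pos
  have hs := ha.s_pos
  have hx' := phi₃_mapsTo hf hx
  have hyq : y.2.2 = x.2.2 := by rcases hy with rfl | rfl <;> rfl
  have hzq : z.2.2 = s * x.1 * x.2.1 - x.2.2 := by rcases hz with rfl | rfl <;> rfl
  intro h
  rcases (sidesOf_eq_iff hf hs y z).1 h with ⟨h1, -⟩ | ⟨h1, -⟩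
  · exact hq (by linarith)
  · have h2 : s * z.1 * z.2.1 = s * x.1 * x.2.1 := by linarith
    rcases hz with rfl | rfl
    · refine sidesOf_phi₁_ne ha hx' ((sidesOf_eq_iff hf hs _ _).2 (Or.inl ⟨rfl, h2⟩))
    · refine sidesOf_phi₂_ne ha hx' ((sidesOf_eq_iff hf hs _ _).2 (Or.inl ⟨rfl, h2⟩))

theorem encard_neighborSet_of_ne_root {g : ℕ} {f s : ℤ} {root : ℤ × ℤ}
    (hr : IsRootPair f s root) (hg : (g : ℤ) = f * s) {p : sidePairs g} (hp : p.1 ≠ root) :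
    ((sideGraph g).neighborSet p).encard = 4 := by
  have ha := hr.admissible
  have hf := ha.f_pos
  have hs := ha.s_pos
  obtain ⟨x, hx, hxp, -⟩ := exists_reduced ha hg p.2
  rw [← hxp] at hp
  rw [encard_neighborSet ha hg hx hxp]
  have hmn := fst_ne_snd_of_ne_root hr hx hp
  have hq := two_mul_ne_phi₃_of_ne_root hr hx hp
  have h12 := sidesOf_phi₁_ne_sidesOf_phi₂ hf hs hx hmn
  have h34 := sidesOf_phi₁_ne_sidesOf_phi₂ hf hs (phi₃_mapsTo hf hx) hmn
  have h13 := sidesOf_phi_ne_sidesOf_phi_phi₃ ha hx hq (Or.inl rfl) (Or.inl rfl)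
  have h14 := sidesOf_phi_ne_sidesOf_phi_phi₃ ha hx hq (Or.inl rfl) (Or.inr rfl)
  have h23 := sidesOf_phi_ne_sidesOf_phi_phi₃ ha hx hq (Or.inr rfl) (Or.inl rfl)
  have h24 := sidesOf_phi_ne_sidesOf_phi_phi₃ ha hx hq (Or.inr rfl) (Or.inr rfl)
  rw [Set.encard_insert_of_notMem (by simp [h12, h13, h14]),
    Set.encard_insert_of_notMem (by simp [h23, h24]), Set.encard_pair h34]
  norm_num

theorem encard_neighborSet_three (hr : ((3, 6) : ℤ × ℤ) ∈ sidePairs 3) :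
    ((sideGraph 3).neighborSet ⟨(3, 6), hr⟩).encard = 2 := by
  have ha : Admissible 1 3 := Or.inl ⟨rfl, rfl⟩
  -- At `(1, 1, 1)` the images under `φ₁` and `φ₂` agree because `m = n`. For `(4, 4)` below, `φ₃`
  -- fixes the root solution as well, leaving one neighbour.
  rw [encard_neighborSet ha (by norm_num) (one_mem_solutions ha (by norm_num))
    (sidesOf_eq_root (Or.inl ⟨rfl, rfl, rfl⟩) (Or.inr ⟨by norm_num, rfl⟩))]
  norm_num [sidesOf, sortPair, phi₁, phi₂, phi₃]
  exact Set.encard_pair (by norm_num)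

theorem encard_neighborSet_four (hr : ((4, 4) : ℤ × ℤ) ∈ sidePairs 4) :
    ((sideGraph 4).neighborSet ⟨(4, 4), hr⟩).encard = 1 := by
  have ha : Admissible 2 2 := Or.inr (Or.inl ⟨rfl, rfl⟩)
  rw [encard_neighborSet ha (by norm_num) (one_mem_solutions ha (by norm_num))
    (sidesOf_eq_root (Or.inr (Or.inl ⟨rfl, rfl, rfl⟩)) (Or.inr ⟨by norm_num, rfl⟩))]
  norm_num [sidesOf, sortPair, phi₁, phi₂, phi₃]

theorem encard_neighborSet_five (hr : ((5, 5) : ℤ × ℤ) ∈ sidePairs 5) :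
    ((sideGraph 5).neighborSet ⟨(5, 5), hr⟩).encard = 2 := by
  have ha : Admissible 5 1 := Or.inr (Or.inr ⟨rfl, rfl⟩)
  have h3 : phi₃ 1 (1, 2, 1) = (1, 2, 1) := by norm_num [phi₃]
  rw [encard_neighborSet ha (by norm_num) one_two_one_mem_solutions
    (sidesOf_eq_root (Or.inr (Or.inr ⟨rfl, rfl, rfl⟩)) (Or.inl ⟨rfl, Or.inl rfl⟩)), h3]
  norm_num [sidesOf, sortPair, phi₁, phi₂]
  exact Set.encard_pair (by norm_num)

end LEP

end

theorem mainTheorem4 (g : ℕ) (f s : ℤ) (root : ℤ × ℤ) (d : ℕ∞)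
    (h : (g = 3 ∧ f = 1 ∧ s = 3 ∧ root = (3, 6) ∧ d = 2) ∨
      (g = 4 ∧ f = 2 ∧ s = 2 ∧ root = (4, 4) ∧ d = 1) ∨
      (g = 5 ∧ f = 5 ∧ s = 1 ∧ root = (5, 5) ∧ d = 2)) :
    -- `T_g` is an infinite tree
    Infinite (LEP.sidePairs g) ∧
    (LEP.sideGraph g).IsTree ∧
    -- the four maps act on `T_g`, and the neighbours of a vertex are its images
    (∀ p ∈ LEP.sidePairs g, ∀ F ∈ LEP.sideMaps,
      ∃ p' ∈ LEP.sidePairs g, LEP.sortPair (F (LEP.toReal p)) = LEP.toReal p') ∧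
    (∀ p p' : LEP.sidePairs g, (LEP.sideGraph g).Adj p p' ↔
      ∃ F ∈ LEP.sideMaps, LEP.sortPair (F (LEP.toReal p.1)) = LEP.toReal p'.1) ∧
    -- the solution graph
    Set.MapsTo (LEP.phi₁ f s) (LEP.solutions f s) (LEP.solutions f s) ∧
    Set.MapsTo (LEP.phi₂ f s) (LEP.solutions f s) (LEP.solutions f s) ∧
    Set.MapsTo (LEP.phi₃ s) (LEP.solutions f s) (LEP.solutions f s) ∧
    (g ≠ 5 → (LEP.solutionGraph f s).IsTree) ∧
    (g = 5 → (LEP.solutionGraph f s).IsAcyclic ∧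
      ∀ x y : LEP.solutions f s, (LEP.solutionGraph f s).Reachable x y ↔
        ¬ (LEP.solutionGraph f s).Reachable x (LEP.swap y)) ∧
    -- its quotient by the swap is a tree, and contracting the `φ₃`-edges there yields `T_g`
    (LEP.swapQuotient f s).IsTree ∧
    (∃ e : LEP.contractedGraph f s ≃g LEP.sideGraph g,
      ∀ x : LEP.solutions f s, (e (Quot.mk _ (Quot.mk _ x))).1 = LEP.sidesOf f s x.1) ∧
    -- the root, the vertex with the least sum of entries, and the degrees
    (∀ p ∈ LEP.sidePairs g, p ≠ root → root.1 + root.2 < p.1 + p.2) ∧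
    (∃ hr : root ∈ LEP.sidePairs g, ((LEP.sideGraph g).neighborSet ⟨root, hr⟩).encard = d) ∧
    (∀ p : LEP.sidePairs g, p.1 ≠ root → ((LEP.sideGraph g).neighborSet p).encard = 4) := by

  have hr : LEP.IsRootPair f s root := by
    rcases h with ⟨-, hf, hs, hr, -⟩ | ⟨-, hf, hs, hr, -⟩ | ⟨-, hf, hs, hr, -⟩
    · exact Or.inl ⟨hf, hs, hr⟩
    · exact Or.inr (Or.inl ⟨hf, hs, hr⟩)
    · exact Or.inr (Or.inr ⟨hf, hs, hr⟩)
  have hg : (g : ℤ) = f * s := by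
    rcases h with ⟨rfl, rfl, rfl, -⟩ | ⟨rfl, rfl, rfl, -⟩ | ⟨rfl, rfl, rfl, -⟩ <;> norm_num
  have ha := hr.admissible
  have hf := ha.f_pos
  refine ⟨LEP.sidePairs_infinite hr hg, LEP.sideGraph_isTree hr hg,
    fun p hp F hF => LEP.exists_sideMap_image ha hg hp hF, LEP.sideGraph_adj_iff ha hg,
    LEP.phi₁_mapsTo hf, LEP.phi₂_mapsTo hf, LEP.phi₃_mapsTo hf, ?_, ?_,
    LEP.swapQuotient_isTree ha, ⟨LEP.contractedIso ha hg, fun _ => rfl⟩,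
    fun p hp hne => LEP.root_sum_lt hr hg hp hne, ⟨LEP.root_mem hr hg, ?_⟩,
    fun p hp => LEP.encard_neighborSet_of_ne_root hr hg hp⟩
  · intro h5
    refine LEP.solutionGraph_isTree ha fun hf5 => h5 ?_
    rcases h with h | h | h <;> omega
  · rintro rfl
    obtain ⟨rfl, rfl⟩ : f = 5 ∧ s = 1 := by
      rcases h with h | h | h <;> omega
    exact ⟨LEP.solutionGraph_isAcyclic hf, LEP.reachable_iff_not_reachable_swap⟩
  · rcases h with ⟨rfl, rfl, rfl, rfl, rfl⟩ | ⟨rfl, rfl, rfl, rfl, rfl⟩ | ⟨rfl, rfl, rfl, rfl, rfl⟩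
    · exact LEP.encard_neighborSet_three _
    · exact LEP.encard_neighborSet_four _
    · exact LEP.encard_neighborSet_five _
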